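/- Let $M\in\mathbb N_0$ and let $\xi^{(k)}_m$ ($m,k\ge 1$) be $\mathbb N_0$-valued random variables on a probability space such that (i) the random quantities $(\xi^{(k)}_1,\dots,\xi^{(k)}_M)$ ($k\ge1$) and $\xi^{(k)}_m$ ($m>M$, $k\ge 1$) are independent; (ii) the random vectors $(\xi^{(k)}_1,\dots,\xi^{(k)}_M)$, $k\ge 1$, are identically distributed, are equal to the zero vector with positive probability, and have a finite fourth moment; (iii) for all $m>M$ and $k\ge 1$, $\xi^{(k)}_m$ is geometrically distributed with parameter $1/2$ and mean $1$, i.e. $P[\xi^{(k)}_m=j]=2^{-j-1}$ for $j\ge 0$. Put $\delta:=E\big[\sum_{m=1}^M(\xi^{(1)}_m-1)\big]$. For $n\in\mathbb N_0$ let $V=(V_k)_{k\ge 0}$ be the (forward branching) process started at $n$, that is, $V_0:=n$ and $V_{k+1}:=\sum_{m=1}^{V_k}\xi^{(k+1)}_m$ for $k\ge 0$, and let $h(n):=P_n[\sigma_0^V<\infty]$ be its extinction probability, where $\sigma_0^V:=\inf\{k\ge 0: V_k\le 0\}$ with $\inf\emptyset:=\infty$. If $\delta>1$, then there is a constant $c\in(0,\infty)$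 such that $$\lim_{n\to\infty} n^{\delta-1}h(n)=c.$$ -/

import Mathlib

open MeasureTheory ProbabilityTheory Filter Topology

noncomputable section

/-- The parameter `1/2` of the geometric distribution, as a point of the unit interval. -/
def halfParam : unitInterval := ⟨1 / 2, by norm_num, by norm_num⟩

/-- The forward branching process started from `n` individuals. Individuals and generations are
numbered from `0`: `ξ k m` is the number of children of the `m`-th individual of generation `k`
(if there is such an individual), so that `V_{k+1} = ∑_{m < V_k} ξ k m`. -/
def forwardBP {Ω : Type*} (ξ : ℕ → ℕ → Ω → ℕ) (n : ℕ) : ℕ → Ω → ℕ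
  | 0, _ => n
  | k + 1, ω => ∑ m ∈ Finset.range (forwardBP ξ n k ω), ξ k m ω

/-- The offspring vector of the first `M` individuals of generation `k`. -/
def firstOffspring {Ω : Type*} (M : ℕ) (ξ : ℕ → ℕ → Ω → ℕ) (k : ℕ) (ω : Ω) : Fin M → ℕ :=
  fun m => ξ k m ω

/-- The σ-algebras generated by the random quantities that are required to be independent:
the vector of the first `M` offspring variables of generation `k` (index `inl k`), and
the single variable `ξ k (M + j)` (index `inr (k, j)`). -/
abbrev offspringSigma {Ω : Type*} (M : ℕ) (ξ : ℕ → ℕ → Ω → ℕ) : ℕ ⊕ (ℕ × ℕ) → MeasurableSpace Ω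
  | Sum.inl k => MeasurableSpace.comap (firstOffspring M ξ k) inferInstance
  | Sum.inr (k, j) => MeasurableSpace.comap (ξ k (M + j)) inferInstance

/-- The assumptions on the offspring variables of the forward branching process. -/
structure IsForwardOffspring {Ω : Type*} [MeasurableSpace Ω] (μ : Measure Ω) (M : ℕ)
    (ξ : ℕ → ℕ → Ω → ℕ) : Prop where
  measurable : ∀ k m, Measurable (ξ k m)
  indep : iIndep (offspringSigma M ξ) μ
  identDistrib : ∀ k, IdentDistrib (firstOffspring M ξ k) (firstOffspring M ξ 0) μ μ
  vanish_pos : 0 < μ {ω | firstOffspring M ξ 0 ω = 0}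
  fourth_moment : ∀ m < M, Integrable (fun ω => (ξ 0 m ω : ℝ) ^ 4) μ
  geometric : ∀ k m, M ≤ m → HasLaw (ξ k m) (geometricMeasure halfParam) μ

/-- The drift parameter `δ = E[∑_{m < M} (ξ 0 m - 1)]`. -/
def driftParam {Ω : Type*} [MeasurableSpace Ω] (μ : Measure Ω) (M : ℕ)
    (ξ : ℕ → ℕ → Ω → ℕ) : ℝ :=
  ∫ ω, ∑ m ∈ Finset.range M, ((ξ 0 m ω : ℝ) - 1) ∂μ

/-- The entrance time `inf {k : f k ≤ y}` of a sequence into `(-∞, y]`, with `inf ∅ = ∞`. -/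
def entranceTime (f : ℕ → ℕ) (y : ℕ) : ℕ∞ := ⨅ (k : ℕ) (_ : f k ≤ y), (k : ℕ∞)

/-- The extinction probability `h(n) = P_n[σ_0^V < ∞]`. -/
def extinctionProb {Ω : Type*} [MeasurableSpace Ω] (μ : Measure Ω)
    (ξ : ℕ → ℕ → Ω → ℕ) (n : ℕ) : ℝ :=
  μ.real {ω | entranceTime (fun k => forwardBP ξ n k ω) 0 < ⊤}

end

noncomputable section

/-! Write κ_v for `offspringLaw μ ξ v`, the law of the next generation when the present one has size
v. A function u with u(0) = 1 that tends to 0 at infinity and is κ-harmonic off 0 must be the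
extinction probability (`extinctionProb_eq_of_harmonic`): the mean of u(V_k) is constant in k, while
V_k leaves every positive state, so in the limit only the mass absorbed at 0 contributes. It remains
to build such a u explicitly enough to read off its decay (`exists_harmonic`).

For v ≥ M the generating function of κ_v is G(z) f(z)^v with f(z) = 1/(2 - z) and G(z) = pgf(κ_M)(z)
(2 - z)^M. Put Φ(n, s) = ∑_k ∏_{i<k} G(f_i(s)) · f_k(s)^n, where f_k is the k-th iterate of f
(`genSum`). Integrating against κ_v shifts k by one, so it returns Φ(v, s) - s^v
(`sum_mul_integral_genSum`). Hence the j-th Taylor coefficient in s is harmonic at every v ≥ M other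
than j. The coefficients with j < M provide M free parameters for M conditions: value 1 at 0, and
harmonicity at 1, ..., M - 1. The maximum principle `le_zero_of_harmonic` makes this square system
invertible.

The map f is parabolic at 1, so 1 - f_k(s) ~ 1/k. Since G(z) = 1 - δ(1 - z) + O(|1 - z|²), the
products behave like C(s) k^{-δ}. Then n^{δ-1} Φ(n, s) is essentially a Riemann sum converging to
C(s) ∫ x^{-δ} e^{-1/x} dx over (0, ∞), finite because δ > 1. A bound uniform in |s| ≤ 1/2 transfers
the convergence to Taylor coefficients, hence to u. The limit is positive because u dominates a
positive multiple of Φ(·, 0), whose constant is visibly positive. -/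

/-! ### Series as integrals of step functions, and their scaling limit -/

theorem map_natFloor_volume :
    (volume.restrict (Set.Ici (0 : ℝ))).map (fun x : ℝ => ⌊x⌋₊) = Measure.count := by
  refine Measure.ext_of_singleton fun k => ?_
  rw [Measure.map_apply Nat.measurable_floor (measurableSet_singleton k),
    Measure.restrict_apply (Nat.measurable_floor (measurableSet_singleton k)),
    Measure.count_singleton]
  have : (fun x : ℝ => ⌊x⌋₊) ⁻¹' {k} ∩ Set.Ici 0 = Set.Ico (k : ℝ) (k + 1) := by
    ext x
    simp only [Set.mem_inter_iff, Set.mem_preimage, Set.mem_singleton_iff, Set.mem_Ici,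
      Set.mem_Ico]
    constructor
    · rintro ⟨h, hx⟩
      exact (Nat.floor_eq_iff hx).1 h
    · rintro h
      have hx : 0 ≤ x := le_trans (Nat.cast_nonneg k) h.1
      exact ⟨(Nat.floor_eq_iff hx).2 h, hx⟩
  rw [this, Real.volume_Ico]
  simp

/-- This exact identity lets dominated convergence on (0, ∞) replace Riemann-sum error estimates. -/
theorem integral_comp_natFloor_mul {a : ℕ → ℂ} (ha : Summable fun k => ‖a k‖) {n : ℕ}
    (hn : 0 < n) :
    ∫ x in Set.Ioi (0 : ℝ), a ⌊(n : ℝ) * x⌋₊ = (n : ℂ)⁻¹ * ∑' k, a k := by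
  have hn' : (0 : ℝ) < n := by exact_mod_cast hn
  have hi : Integrable a Measure.count := by
    rw [integrable_count_iff]; exact ha
  have h1 := integral_comp_mul_left_Ioi (fun x : ℝ => a ⌊x⌋₊) 0 hn'
  rw [mul_zero] at h1
  rw [h1, ← integral_Ici_eq_integral_Ioi,
    ← integral_map (μ := volume.restrict (Set.Ici (0 : ℝ))) (φ := fun x : ℝ => ⌊x⌋₊) (f := a)
      Nat.measurable_floor.aemeasurable (measurable_of_countable a).aestronglyMeasurable,
    map_natFloor_volume, integral_countable hi]
  simp [Measure.real]

/-- The exponential absorbs the singularity at 0: apply t ≤ e^t with t = (1 + 1/y)/(2δ) and raise to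
the power δ. -/
theorem rpow_neg_mul_exp_le {δ y : ℝ} (hδ : 0 < δ) (hy : 0 < y) :
    y ^ (-δ) * Real.exp (-(1 / (2 * y))) ≤
      (2 * δ) ^ δ * Real.exp (1 / 2) * (1 + y) ^ (-δ) := by
  have h1 : (1 + y⁻¹) ^ δ ≤ (2 * δ) ^ δ * Real.exp (1 / 2 + 1 / (2 * y)) := by
    have h2 : 1 + y⁻¹ ≤ 2 * δ * Real.exp ((1 + y⁻¹) / (2 * δ)) := by
      have := Real.add_one_le_exp ((1 + y⁻¹) / (2 * δ))
      have h3 : (1 + y⁻¹) / (2 * δ) ≤ Real.exp ((1 + y⁻¹) / (2 * δ)) := by linarith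
      rw [div_le_iff₀ (by positivity)] at h3
      linarith
    calc (1 + y⁻¹) ^ δ ≤ (2 * δ * Real.exp ((1 + y⁻¹) / (2 * δ))) ^ δ := by gcongr
      _ = _ := by
        rw [Real.mul_rpow (by positivity) (by positivity), ← Real.exp_mul]
        congr 2
        field_simp
  have h4 : (1 + y⁻¹) ^ δ = (1 + y) ^ δ * y ^ (-δ) := by
    rw [Real.rpow_neg hy.le, ← Real.inv_rpow hy.le, ← Real.mul_rpow (by positivity) (by positivity)]
    congr 1
    field_simp
    ring
  rw [h4, Real.exp_add] at h1
  rw [Real.rpow_neg (by positivity : (0:ℝ) ≤ 1 + y), Real.exp_neg, ← div_eq_mul_inv,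
    ← div_eq_mul_inv, div_le_div_iff₀ (by positivity) (by positivity)]
  linarith

/-- The `n`-th rescaled summand, as a function of the continuous variable `x`. -/
def scaledTerm (δ : ℝ) (B z : ℕ → ℂ) (n : ℕ) (x : ℝ) : ℂ :=
  ((((⌊(n : ℝ) * x⌋₊ : ℝ) + 1) / n) ^ (-δ) : ℝ) * (B ⌊(n : ℝ) * x⌋₊ * z ⌊(n : ℝ) * x⌋₊ ^ n)

/-- The integrable majorant of the rescaled summands. -/
def scaledMajorant (δ : ℝ) (x : ℝ) : ℝ :=
  (2 * δ) ^ δ * Real.exp (1 / 2) * (1 + x) ^ (-δ)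

theorem integrableOn_scaledMajorant {δ : ℝ} (hδ : 1 < δ) :
    IntegrableOn (scaledMajorant δ) (Set.Ioi 0) := by
  refine Integrable.const_mul ?_ _
  have := integrableOn_add_rpow_Ioi_of_lt (a := -δ) (c := 0) (m := 1) (by linarith) (by norm_num)
  simpa [add_comm, IntegrableOn] using this

theorem norm_scaledTerm_le {δ : ℝ} (hδ : 1 < δ) {B z : ℕ → ℂ} {K : ℝ} (hB : ∀ k, ‖B k‖ ≤ K)
    (hz : ∀ k : ℕ, ‖z k‖ ≤ ((k : ℝ) + 1) / (k + 2)) {n : ℕ} (hn : 0 < n) {x : ℝ} (hx : 0 < x) :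
    ‖scaledTerm δ B z n x‖ ≤ K * scaledMajorant δ x := by
  have hn' : (0 : ℝ) < n := by exact_mod_cast hn
  unfold scaledTerm
  set k := ⌊(n : ℝ) * x⌋₊ with hk
  have hK : 0 ≤ K := (norm_nonneg _).trans (hB 0)
  set y : ℝ := ((k : ℝ) + 1) / n with hy
  have hy0 : 0 < y := by positivity
  have hxy : x ≤ y := by
    rw [hy, le_div_iff₀ hn', mul_comm]
    exact (Nat.lt_floor_add_one _).le
  have hzn : ‖z k‖ ^ n ≤ Real.exp (-(1 / (2 * y))) := by
    have h1 : ‖z k‖ ≤ Real.exp (-(1 / ((k : ℝ) + 2))) := by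
      refine (hz k).trans ?_
      have := Real.add_one_le_exp (-(1 / ((k : ℝ) + 2)))
      refine le_trans (le_of_eq ?_) this
      field_simp
      ring
    calc ‖z k‖ ^ n ≤ Real.exp (-(1 / ((k : ℝ) + 2))) ^ n := by gcongr
      _ = Real.exp (-((n : ℝ) / (k + 2))) := by
        rw [← Real.exp_nat_mul]; congr 1; ring
      _ ≤ _ := by
        -- With y = (k + 1)/n this is k + 2 ≤ 2(k + 1), the source of the factor 2 in the exponent.
        have h2 : 1 / (2 * y) ≤ (n : ℝ) / (k + 2) := by
          rw [hy, div_le_div_iff₀ (by positivity) (by positivity)]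
          field_simp
          linarith
        exact Real.exp_le_exp.2 (neg_le_neg h2)
  rw [norm_mul, norm_mul, norm_pow, Complex.norm_real, Real.norm_of_nonneg (by positivity)]
  calc y ^ (-δ) * (‖B k‖ * ‖z k‖ ^ n)
      ≤ y ^ (-δ) * (K * Real.exp (-(1 / (2 * y)))) := by gcongr; exact hB k
    _ = K * (y ^ (-δ) * Real.exp (-(1 / (2 * y)))) := by ring
    _ ≤ K * ((2 * δ) ^ δ * Real.exp (1 / 2) * (1 + y) ^ (-δ)) := by
        exact mul_le_mul_of_nonneg_left (rpow_neg_mul_exp_le (by linarith) hy0) hK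
    _ ≤ K * scaledMajorant δ x := by
        unfold scaledMajorant
        gcongr K * (_ * ?_)
        refine Real.rpow_le_rpow_of_nonpos (by positivity) (by linarith) (by linarith)

/-- Here k = ⌊nx⌋ ~ nx and z_k = 1 - (1 + o(1))/k, so z_k^n tends to e^{-1/x}. -/
theorem tendsto_scaledTerm {δ : ℝ} {B z : ℕ → ℂ} {C : ℂ} (hBC : Tendsto B atTop (𝓝 C))
    (hz1 : Tendsto (fun k : ℕ => (k : ℂ) * (1 - z k)) atTop (𝓝 1)) {x : ℝ} (hx : 0 < x) :
    Tendsto (fun n => scaledTerm δ B z n x) atTop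
      (𝓝 (C * ((x ^ (-δ) * Real.exp (-(1 / x)) : ℝ) : ℂ))) := by
  unfold scaledTerm
  have hk : Tendsto (fun n : ℕ => ⌊(n : ℝ) * x⌋₊) atTop atTop :=
    tendsto_nat_floor_atTop.comp (tendsto_natCast_atTop_atTop.atTop_mul_const hx)
  have hdiv : Tendsto (fun n : ℕ => (⌊(n : ℝ) * x⌋₊ : ℝ) / n) atTop (𝓝 x) := by
    have := (tendsto_nat_floor_mul_div_atTop hx.le).comp
      (tendsto_natCast_atTop_atTop (R := ℝ))
    simpa [Function.comp_def, mul_comm] using this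
  have hdiv1 : Tendsto (fun n : ℕ => ((⌊(n : ℝ) * x⌋₊ : ℝ) + 1) / n) atTop (𝓝 x) := by
    have := hdiv.add (tendsto_const_div_atTop_nhds_zero_nat (1 : ℝ))
    simpa [add_div] using this
  have h1 : Tendsto (fun n : ℕ => (((((⌊(n : ℝ) * x⌋₊ : ℝ) + 1) / n) ^ (-δ) : ℝ) : ℂ)) atTop
      (𝓝 ((x ^ (-δ) : ℝ) : ℂ)) :=
    (Complex.continuous_ofReal.tendsto _).comp (hdiv1.rpow_const (Or.inl hx.ne'))
  have h2 : Tendsto (fun n : ℕ => z ⌊(n : ℝ) * x⌋₊ ^ n) atTop (𝓝 (Complex.exp (-(1 / x : ℝ)))) := by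
    have h3 : Tendsto (fun n : ℕ => (n : ℂ) * (z ⌊(n : ℝ) * x⌋₊ - 1)) atTop
        (𝓝 (-((1 / x : ℝ) : ℂ))) := by
      have h4 : Tendsto (fun n : ℕ => ((((⌊(n : ℝ) * x⌋₊ : ℝ) / n)⁻¹ : ℝ) : ℂ)) atTop
          (𝓝 ((x⁻¹ : ℝ) : ℂ)) :=
        (Complex.continuous_ofReal.tendsto _).comp (hdiv.inv₀ hx.ne')
      have h5 := (h4.mul (hz1.comp hk)).neg
      rw [mul_one, ← one_div] at h5
      refine h5.congr' ?_
      filter_upwards [hk.eventually_ge_atTop 1, eventually_gt_atTop 0] with n hn hn0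
      have : ((⌊(n : ℝ) * x⌋₊ : ℕ) : ℂ) ≠ 0 := by
        exact_mod_cast (by omega : ⌊(n : ℝ) * x⌋₊ ≠ 0)
      have hn1 : (n : ℂ) ≠ 0 := by exact_mod_cast hn0.ne'
      simp only [Function.comp]
      push_cast
      field_simp
      ring
    have := Complex.tendsto_one_add_pow_exp_of_tendsto h3
    simpa using this
  have := h1.mul ((hBC.comp hk).mul h2)
  have hlim : C * ((x ^ (-δ) * Real.exp (-(1 / x)) : ℝ) : ℂ) =
      ((x ^ (-δ) : ℝ) : ℂ) * (C * Complex.exp (-(1 / x : ℝ))) := by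
    push_cast
    ring
  rwa [hlim]

/-- The constant `∫_0^∞ x^{-δ} e^{-1/x} dx`. -/
def scalingConst (δ : ℝ) : ℝ := ∫ x in Set.Ioi (0 : ℝ), x ^ (-δ) * Real.exp (-(1 / x))

theorem scalingConst_pos {δ : ℝ} (hδ : 1 < δ) : 0 < scalingConst δ := by
  have hm : AEStronglyMeasurable (fun x : ℝ => x ^ (-δ) * Real.exp (-(1 / x)))
      (volume.restrict (Set.Ioi 0)) := by
    apply Measurable.aestronglyMeasurable
    fun_prop
  have hle : ∀ x ∈ Set.Ioi (0 : ℝ), ‖x ^ (-δ) * Real.exp (-(1 / x))‖ ≤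
      2 ^ δ * scaledMajorant δ x := by
    intro x hx
    have hx : 0 < x := hx
    have h2 := rpow_neg_mul_exp_le (δ := δ) (by linarith) hx
    rw [Real.norm_of_nonneg (by positivity)]
    have h3 : Real.exp (-(1 / x)) ≤ Real.exp (-(1 / (2 * x))) := by
      gcongr; linarith
    have h4 : (1 : ℝ) ≤ 2 ^ δ := Real.one_le_rpow (by norm_num) (by linarith)
    have h5 : 0 ≤ scaledMajorant δ x := by unfold scaledMajorant; positivity
    calc x ^ (-δ) * Real.exp (-(1 / x)) ≤ x ^ (-δ) * Real.exp (-(1 / (2 * x))) := by gcongr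
      _ ≤ scaledMajorant δ x := h2
      _ ≤ _ := by nlinarith
  have hint : IntegrableOn (fun x : ℝ => x ^ (-δ) * Real.exp (-(1 / x))) (Set.Ioi 0) :=
    Integrable.mono' ((integrableOn_scaledMajorant hδ).const_mul _) hm
      ((ae_restrict_iff' measurableSet_Ioi).2 (Eventually.of_forall hle))
  refine (setIntegral_pos_iff_support_of_nonneg_ae ?_ hint).2 ?_
  · refine (ae_restrict_iff' measurableSet_Ioi).2 (Eventually.of_forall fun x hx => ?_)
    have hx : 0 < x := hx
    simp only [Pi.zero_apply]
    positivity
  · have : Set.Ioi (0 : ℝ) ⊆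
        Function.support (fun x : ℝ => x ^ (-δ) * Real.exp (-(1 / x))) := by
      intro x hx
      have hx : 0 < x := hx
      simp only [Function.mem_support]
      positivity
    rw [Set.inter_eq_self_of_subset_right this]
    simp

theorem summable_norm_rpow_mul {δ : ℝ} (hδ : 1 < δ) {B z : ℕ → ℂ} {K : ℝ} (hB : ∀ k, ‖B k‖ ≤ K)
    (hz : ∀ k, ‖z k‖ ≤ 1) (n : ℕ) :
    Summable fun k : ℕ => ‖((((k : ℝ) + 1) ^ (-δ) : ℝ) : ℂ) * (B k * z k ^ n)‖ := by
  have h := (summable_nat_add_iff 1).2 (Real.summable_nat_rpow.2 (by linarith : -δ < -1))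
  refine Summable.of_nonneg_of_le (fun _ => norm_nonneg _) (fun k => ?_) (h.mul_right K)
  have hK : 0 ≤ K := (norm_nonneg _).trans (hB 0)
  rw [norm_mul, norm_mul, norm_pow, Complex.norm_real, Real.norm_of_nonneg (by positivity)]
  push_cast
  calc ((k : ℝ) + 1) ^ (-δ) * (‖B k‖ * ‖z k‖ ^ n) ≤ ((k : ℝ) + 1) ^ (-δ) * (K * 1 ^ n) := by
        gcongr
        exacts [hB k, hz k]
    _ = _ := by simp

theorem integral_scaledTerm {δ : ℝ} (hδ : 1 < δ) {B z : ℕ → ℂ} {K : ℝ} (hB : ∀ k, ‖B k‖ ≤ K)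
    (hz : ∀ k, ‖z k‖ ≤ 1) {n : ℕ} (hn : 0 < n) :
    ∫ x in Set.Ioi (0 : ℝ), scaledTerm δ B z n x =
      (((n : ℝ) ^ (δ - 1) : ℝ) : ℂ) *
        ∑' k : ℕ, ((((k : ℝ) + 1) ^ (-δ) : ℝ) : ℂ) * (B k * z k ^ n) := by
  have hn' : (0 : ℝ) < n := by exact_mod_cast hn
  have h1 : ∀ x : ℝ, scaledTerm δ B z n x = (((n : ℝ) ^ δ : ℝ) : ℂ) *
      (fun k : ℕ => ((((k : ℝ) + 1) ^ (-δ) : ℝ) : ℂ) * (B k * z k ^ n)) ⌊(n : ℝ) * x⌋₊ := by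
    intro x
    unfold scaledTerm
    rw [Real.div_rpow (by positivity) hn'.le, Real.rpow_neg hn'.le δ, div_inv_eq_mul]
    push_cast
    ring
  simp_rw [h1]
  rw [integral_const_mul, integral_comp_natFloor_mul (summable_norm_rpow_mul hδ hB hz n) hn,
    ← mul_assoc]
  congr 1
  rw [Real.rpow_sub hn', Real.rpow_one, div_eq_mul_inv]
  push_cast
  ring

theorem norm_scaled_tsum_le {δ : ℝ} (hδ : 1 < δ) {B z : ℕ → ℂ} {K : ℝ} (hB : ∀ k, ‖B k‖ ≤ K)
    (hz : ∀ k : ℕ, ‖z k‖ ≤ ((k : ℝ) + 1) / (k + 2)) {n : ℕ} (hn : 0 < n) :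
    ‖(((n : ℝ) ^ (δ - 1) : ℝ) : ℂ) *
        ∑' k : ℕ, ((((k : ℝ) + 1) ^ (-δ) : ℝ) : ℂ) * (B k * z k ^ n)‖ ≤
      K * ∫ x in Set.Ioi (0 : ℝ), scaledMajorant δ x := by
  have hz' : ∀ k, ‖z k‖ ≤ 1 := fun k => (hz k).trans (by
    rw [div_le_one (by positivity)]; linarith)
  rw [← integral_scaledTerm hδ hB hz' hn, ← integral_const_mul]
  refine norm_integral_le_of_norm_le ((integrableOn_scaledMajorant hδ).const_mul K) ?_
  exact (ae_restrict_iff' measurableSet_Ioi).2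
    (Eventually.of_forall fun x hx => norm_scaledTerm_le hδ hB hz hn hx)

theorem tendsto_scaled_tsum {δ : ℝ} (hδ : 1 < δ) {B z : ℕ → ℂ} {K : ℝ} (hB : ∀ k, ‖B k‖ ≤ K)
    {C : ℂ} (hBC : Tendsto B atTop (𝓝 C))
    (hz : ∀ k : ℕ, ‖z k‖ ≤ ((k : ℝ) + 1) / (k + 2))
    (hz1 : Tendsto (fun k : ℕ => (k : ℂ) * (1 - z k)) atTop (𝓝 1)) :
    Tendsto (fun n : ℕ => (((n : ℝ) ^ (δ - 1) : ℝ) : ℂ) *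
        ∑' k : ℕ, ((((k : ℝ) + 1) ^ (-δ) : ℝ) : ℂ) * (B k * z k ^ n)) atTop
      (𝓝 (C * scalingConst δ)) := by
  have hz' : ∀ k, ‖z k‖ ≤ 1 := fun k => (hz k).trans (by
    rw [div_le_one (by positivity)]; linarith)
  have hlim : ∫ x in Set.Ioi (0 : ℝ), C * ((x ^ (-δ) * Real.exp (-(1 / x)) : ℝ) : ℂ) =
      C * scalingConst δ := by
    rw [integral_const_mul, integral_complex_ofReal, scalingConst]
  rw [← hlim]
  have key := tendsto_integral_filter_of_dominated_convergence
    (μ := volume.restrict (Set.Ioi (0 : ℝ))) (l := atTop) (F := fun n x => scaledTerm δ B z n x)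
    (f := fun x => C * ((x ^ (-δ) * Real.exp (-(1 / x)) : ℝ) : ℂ))
    (fun x => K * scaledMajorant δ x) ?_ ?_ ((integrableOn_scaledMajorant hδ).const_mul K) ?_
  · refine key.congr' ?_
    filter_upwards [eventually_gt_atTop 0] with n hn
    exact integral_scaledTerm hδ hB hz' hn
  · refine Eventually.of_forall fun n => Measurable.aestronglyMeasurable ?_
    have hf : Measurable fun x : ℝ => ⌊(n : ℝ) * x⌋₊ :=
      Nat.measurable_floor.comp (measurable_const_mul _)
    exact (measurable_of_countable fun k : ℕ =>
      (((((k : ℝ) + 1) / n) ^ (-δ) : ℝ) : ℂ) * (B k * z k ^ n)).comp hf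
  · filter_upwards [eventually_gt_atTop 0] with n hn
    exact (ae_restrict_iff' measurableSet_Ioi).2
      (Eventually.of_forall fun x hx => norm_scaledTerm_le hδ hB hz hn hx)
  · exact (ae_restrict_iff' measurableSet_Ioi).2
      (Eventually.of_forall fun x hx => tendsto_scaledTerm hBC hz1 hx)

/-! ### Iterates of the parabolic Möbius map -/

/-- The iterates of the Möbius map `s ↦ 1 / (2 - s)`, the probability generating function of the
geometric distribution with parameter `1/2`. -/
def mobiusIter : ℕ → ℂ → ℂ
  | 0, s => s
  | k + 1, s => 1 / (2 - mobiusIter k s)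

theorem two_sub_ne_zero_of_norm_le_one {z : ℂ} (hz : ‖z‖ ≤ 1) : 2 - z ≠ 0 := by
  intro h
  have : z = 2 := by linear_combination -h
  rw [this] at hz
  norm_num at hz

/-- The bound is the orbit of 1/2 itself: |1/(2 - z)| ≤ 1/(2 - |z|) propagates it. -/
theorem norm_mobiusIter_le {s : ℂ} (hs : ‖s‖ ≤ 1 / 2) (k : ℕ) :
    ‖mobiusIter k s‖ ≤ ((k : ℝ) + 1) / (k + 2) := by
  induction k with
  | zero => simpa [mobiusIter] using hs
  | succ k ih =>
    rw [mobiusIter, norm_div, norm_one]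
    have h1 : 2 - ‖mobiusIter k s‖ ≤ ‖2 - mobiusIter k s‖ := by
      have := norm_sub_norm_le (2 : ℂ) (mobiusIter k s)
      simpa using this
    have h2 : ((k : ℝ) + 3) / (k + 2) ≤ ‖2 - mobiusIter k s‖ := by
      refine le_trans ?_ h1
      refine le_trans (le_of_eq ?_) (sub_le_sub_left ih 2)
      field_simp
      ring
    calc 1 / ‖2 - mobiusIter k s‖ ≤ 1 / (((k : ℝ) + 3) / (k + 2)) := by gcongr
      _ = _ := by push_cast; field_simp; ring

theorem norm_mobiusIter_le_one {s : ℂ} (hs : ‖s‖ ≤ 1 / 2) (k : ℕ) : ‖mobiusIter k s‖ ≤ 1 :=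
  (norm_mobiusIter_le hs k).trans (by rw [div_le_one (by positivity)]; linarith)

theorem continuousOn_mobiusIter (k : ℕ) :
    ContinuousOn (mobiusIter k) (Metric.closedBall 0 (1 / 2)) := by
  induction k with
  | zero => exact continuousOn_id
  | succ k ih =>
    refine continuousOn_const.div (continuousOn_const.sub ih) fun s hs => ?_
    exact two_sub_ne_zero_of_norm_le_one (norm_mobiusIter_le_one (by simpa using hs) k)

theorem norm_one_add_mul_ge {s : ℂ} (hs : ‖s‖ ≤ 1 / 2) (k : ℕ) :
    ((k : ℝ) + 1) / 2 ≤ ‖1 + (k : ℂ) * (1 - s)‖ := by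
  have h1 : s.re ≤ 1 / 2 := (Complex.re_le_norm s).trans hs
  refine le_trans ?_ (Complex.re_le_norm _)
  have : (1 + (k : ℂ) * (1 - s)).re = 1 + k * (1 - s.re) := by simp
  rw [this]
  have hk : (0 : ℝ) ≤ k := Nat.cast_nonneg k
  nlinarith

/-- In the coordinate 1/(1 - s) the map is translation by 1. -/
theorem one_sub_mobiusIter {s : ℂ} (hs : ‖s‖ ≤ 1 / 2) (k : ℕ) :
    1 - mobiusIter k s = (1 - s) / (1 + k * (1 - s)) := by
  induction k with
  | zero => simp [mobiusIter]
  | succ k ih =>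
    have h0 : 2 - mobiusIter k s ≠ 0 :=
      two_sub_ne_zero_of_norm_le_one (norm_mobiusIter_le_one hs k)
    have h1 : ∀ k : ℕ, 1 + (k : ℂ) * (1 - s) ≠ 0 := fun k h => by
      have := norm_one_add_mul_ge hs k
      rw [h, norm_zero] at this
      have hk : (0 : ℝ) ≤ k := Nat.cast_nonneg k
      linarith
    have h2 : mobiusIter k s = 1 - (1 - s) / (1 + k * (1 - s)) := by rw [← ih]; ring
    have h3 := h1 k
    have h4 := h1 (k + 1)
    have h5 : 2 - mobiusIter k s = (1 + ((k + 1 : ℕ) : ℂ) * (1 - s)) / (1 + k * (1 - s)) := by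
      rw [eq_div_iff h3, h2]
      push_cast
      linear_combination div_mul_cancel₀ (1 - s) h3
    rw [mobiusIter, h5]
    rw [one_div_div, eq_div_iff h4, sub_mul, div_mul_cancel₀ _ h4]
    push_cast
    ring

theorem norm_one_sub_mobiusIter_sub_le {s : ℂ} (hs : ‖s‖ ≤ 1 / 2) (k : ℕ) :
    ‖1 - mobiusIter k s - 1 / ((k : ℂ) + 1)‖ ≤ (1 / ((k : ℝ) + 1)) ^ 2 := by
  have h1 := norm_one_add_mul_ge hs k
  have hk : (0 : ℝ) < k + 1 := by positivity
  have h0 : 1 + (k : ℂ) * (1 - s) ≠ 0 := fun h => by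
    rw [h, norm_zero] at h1
    linarith
  have hk' : (k : ℂ) + 1 ≠ 0 := by exact_mod_cast hk.ne'
  have h2 : 1 - mobiusIter k s - 1 / ((k : ℂ) + 1) =
      -s / ((1 + (k : ℂ) * (1 - s)) * ((k : ℂ) + 1)) := by
    rw [one_sub_mobiusIter hs, eq_div_iff (mul_ne_zero h0 hk')]
    linear_combination ((k : ℂ) + 1) * div_mul_cancel₀ (1 - s) h0 -
      (1 + (k : ℂ) * (1 - s)) * div_mul_cancel₀ (1 : ℂ) hk'
  have h3 : ‖(k : ℂ) + 1‖ = (k : ℝ) + 1 := by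
    have : ((k : ℂ) + 1) = ((k + 1 : ℕ) : ℂ) := by push_cast; rfl
    rw [this, Complex.norm_natCast]; push_cast; rfl
  rw [h2, norm_div, norm_neg, norm_mul, h3]
  calc ‖s‖ / (‖1 + (k : ℂ) * (1 - s)‖ * ((k : ℝ) + 1))
      ≤ (1 / 2) / (((k : ℝ) + 1) / 2 * ((k : ℝ) + 1)) := by gcongr
    _ = _ := by field_simp

theorem norm_one_sub_mobiusIter_le {s : ℂ} (hs : ‖s‖ ≤ 1 / 2) (k : ℕ) :
    ‖1 - mobiusIter k s‖ ≤ 2 * (1 / ((k : ℝ) + 1)) := by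
  have h := norm_one_sub_mobiusIter_sub_le hs k
  have h3 : ‖1 / ((k : ℂ) + 1)‖ = 1 / ((k : ℝ) + 1) := by
    have : ((k : ℂ) + 1) = ((k + 1 : ℕ) : ℂ) := by push_cast; rfl
    rw [norm_div, this, Complex.norm_natCast, norm_one]; push_cast; rfl
  have h4 : 1 / ((k : ℝ) + 1) ≤ 1 := by
    rw [div_le_one (by positivity)]; linarith [(Nat.cast_nonneg k : (0 : ℝ) ≤ k)]
  have h5 : 0 < 1 / ((k : ℝ) + 1) := by positivity
  have h6 := norm_add_le (1 - mobiusIter k s - 1 / ((k : ℂ) + 1)) (1 / ((k : ℂ) + 1))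
  rw [sub_add_cancel, h3] at h6
  nlinarith

theorem tendsto_mul_one_sub_mobiusIter {s : ℂ} (hs : ‖s‖ ≤ 1 / 2) :
    Tendsto (fun k : ℕ => (k : ℂ) * (1 - mobiusIter k s)) atTop (𝓝 1) := by
  rw [tendsto_iff_norm_sub_tendsto_zero]
  have h0 : Tendsto (fun k : ℕ => 3 * (1 / ((k : ℝ) + 1))) atTop (𝓝 0) := by
    simpa using (tendsto_one_div_add_atTop_nhds_zero_nat (𝕜 := ℝ)).const_mul 3
  refine squeeze_zero (fun _ => norm_nonneg _) (fun k => ?_) h0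
  have hk' : (k : ℂ) + 1 ≠ 0 := by exact_mod_cast (by positivity : (k : ℝ) + 1 ≠ 0)
  have h2 : (k : ℂ) * (1 - mobiusIter k s) - 1 =
      ((k : ℂ) + 1) * (1 - mobiusIter k s - 1 / ((k : ℂ) + 1)) - (1 - mobiusIter k s) := by
    field_simp
    ring
  have h3 : ‖(k : ℂ) + 1‖ = (k : ℝ) + 1 := by
    have : ((k : ℂ) + 1) = ((k + 1 : ℕ) : ℂ) := by push_cast; rfl
    rw [this, Complex.norm_natCast]; push_cast; rfl
  have h4 := norm_one_sub_mobiusIter_sub_le hs k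
  have h5 := norm_one_sub_mobiusIter_le hs k
  rw [h2]
  refine (norm_sub_le _ _).trans ?_
  rw [norm_mul, h3]
  have h6 : ((k : ℝ) + 1) * ‖1 - mobiusIter k s - 1 / ((k : ℂ) + 1)‖ ≤
      ((k : ℝ) + 1) * (1 / ((k : ℝ) + 1)) ^ 2 := by gcongr
  have h7 : ((k : ℝ) + 1) * (1 / ((k : ℝ) + 1)) ^ 2 = 1 / ((k : ℝ) + 1) := by field_simp
  linarith

/-! ### Products along the orbit and their power decay -/

/-- The expansion `G z = 1 - δ (1 - z) + O(|1 - z|²)` on the unit disc. -/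
def HasDriftExpansion (G : ℂ → ℂ) (δ : ℝ) : Prop :=
  ∃ K : ℝ, ∀ z, ‖z‖ ≤ 1 → ‖G z - (1 - δ * (1 - z))‖ ≤ K * ‖1 - z‖ ^ 2

theorem abs_one_add_rpow_sub_le {δ y : ℝ} (hδ : 1 ≤ δ) (hy : 0 ≤ y) (hy1 : y ≤ 1) :
    |(1 + y) ^ δ - (1 + δ * y)| ≤ δ ^ 2 * Real.exp δ * y ^ 2 := by
  have h1 := one_add_mul_self_le_rpow_one_add (by linarith : -1 ≤ y) hδ
  rw [abs_of_nonneg (by linarith)]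
  have h2 : (1 + y) ^ δ ≤ Real.exp (δ * y) := by
    have := Real.add_one_le_exp y
    calc (1 + y) ^ δ ≤ Real.exp y ^ δ := by gcongr; linarith
      _ = _ := by rw [← Real.exp_mul, mul_comm]
  set w := δ * y with hw
  have hw0 : 0 ≤ w := by positivity
  have h3 : 1 - w ≤ Real.exp (-w) := by linarith [Real.add_one_le_exp (-w)]
  have h4 : Real.exp w * Real.exp (-w) = 1 := by rw [← Real.exp_add]; simp
  have h5 : 0 < Real.exp w := Real.exp_pos w
  have h6 : Real.exp w - 1 ≤ w * Real.exp w := by nlinarith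
  have h7 : Real.exp w ≤ Real.exp δ := Real.exp_le_exp.2 (by rw [hw]; nlinarith)
  have h8 : Real.exp w - 1 - w ≤ w * (w * Real.exp w) := by nlinarith
  calc (1 + y) ^ δ - (1 + w) ≤ w * (w * Real.exp w) := by linarith
    _ ≤ w * (w * Real.exp δ) := by gcongr
    _ = _ := by rw [hw]; ring

/-- The normalized factors `G (f_i s) ((i + 2) / (i + 1))^δ`. -/
def genFactor (G : ℂ → ℂ) (δ : ℝ) (s : ℂ) (i : ℕ) : ℂ :=
  G (mobiusIter i s) * (((1 + 1 / ((i : ℝ) + 1)) ^ δ : ℝ) : ℂ)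

/-- With y = 1/(i + 1), the factor is (1 - δy + O(y²))(1 + δy + O(y²)); the linear terms cancel,
leaving a summable error uniform in s. -/
theorem exists_norm_genFactor_sub_one_le {G : ℂ → ℂ} {δ : ℝ} (hδ : 1 ≤ δ)
    (hG : HasDriftExpansion G δ) :
    ∃ K : ℝ, 0 ≤ K ∧ ∀ s : ℂ, ‖s‖ ≤ 1 / 2 → ∀ i : ℕ,
      ‖genFactor G δ s i - 1‖ ≤ K * (1 / ((i : ℝ) + 1)) ^ 2 := by
  obtain ⟨K₁, hK₁⟩ := hG
  have hK₁0 : 0 ≤ K₁ := by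
    have := (norm_nonneg _).trans (hK₁ 0 (by simp))
    simpa using this
  -- The term 4K₁ comes from |1 - f_i(s)| ≤ 2y, and δ from replacing 1 - f_i(s) by y at cost y².
  set K₂ := 4 * K₁ + δ with hK₂
  set K₃ := δ ^ 2 * Real.exp δ with hK₃
  have hK₂0 : 0 ≤ K₂ := by positivity
  have hK₃0 : 0 ≤ K₃ := by positivity
  refine ⟨δ ^ 2 + (1 + δ) * K₃ + K₂ * (1 + δ + K₃), by positivity, fun s hs i => ?_⟩
  set y : ℝ := 1 / ((i : ℝ) + 1) with hy
  have hy0 : 0 ≤ y := by positivity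
  have hy1 : y ≤ 1 := by
    rw [hy, div_le_one (by positivity)]; linarith [(Nat.cast_nonneg i : (0 : ℝ) ≤ i)]
  have h1 := norm_one_sub_mobiusIter_sub_le hs i
  have h2 := norm_one_sub_mobiusIter_le hs i
  rw [← hy] at h1 h2
  have hyc : 1 / ((i : ℂ) + 1) = (y : ℂ) := by rw [hy]; push_cast; rfl
  rw [hyc] at h1
  have h3 := hK₁ _ (norm_mobiusIter_le_one hs i)
  set P : ℝ := (1 + y) ^ δ with hP
  have h4 : |P - (1 + δ * y)| ≤ K₃ * y ^ 2 := abs_one_add_rpow_sub_le hδ hy0 hy1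
  have hP0 : 0 ≤ P := by positivity
  have hP1 : P ≤ 1 + δ + K₃ := by
    have h5 := (abs_le.1 h4).2
    have h6 : δ * y ≤ δ * 1 := by gcongr
    have h7 : K₃ * y ^ 2 ≤ K₃ * 1 := by
      gcongr
      exact pow_le_one₀ hy0 hy1
    linarith
  set a : ℂ := G (mobiusIter i s) - (1 - δ * y) with ha
  have h5 : ‖a‖ ≤ K₂ * y ^ 2 := by
    have : a = (G (mobiusIter i s) - (1 - δ * (1 - mobiusIter i s))) -
        δ * (1 - mobiusIter i s - y) := by rw [ha]; ring
    rw [this]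
    refine (norm_sub_le _ _).trans ?_
    rw [norm_mul, Complex.norm_real, Real.norm_of_nonneg (by linarith)]
    have h6 : ‖1 - mobiusIter i s‖ ^ 2 ≤ (2 * y) ^ 2 := by gcongr
    calc _ ≤ K₁ * (2 * y) ^ 2 + δ * y ^ 2 := by
          gcongr
          exact h3.trans (by gcongr)
      _ = _ := by rw [hK₂]; ring
  have h7 : genFactor G δ s i - 1 = ((-(δ ^ 2 * y ^ 2) : ℝ) : ℂ) +
      (((1 - δ * y) * (P - (1 + δ * y)) : ℝ) : ℂ) + a * (P : ℂ) := by
    unfold genFactor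
    rw [← hy, ← hP, ha]
    push_cast
    ring
  rw [h7]
  refine (norm_add₃_le).trans ?_
  rw [norm_mul, Complex.norm_real, Complex.norm_real, Complex.norm_real, Real.norm_of_nonneg hP0,
    norm_neg, Real.norm_of_nonneg (by positivity), norm_mul, Real.norm_eq_abs, Real.norm_eq_abs]
  have h8 : |1 - δ * y| ≤ 1 + δ := by
    rw [abs_le]; constructor <;> nlinarith
  calc δ ^ 2 * y ^ 2 + |1 - δ * y| * |P - (1 + δ * y)| + ‖a‖ * P
      ≤ δ ^ 2 * y ^ 2 + (1 + δ) * (K₃ * y ^ 2) + K₂ * y ^ 2 * (1 + δ + K₃) := by gcongr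
    _ = _ := by ring

/-- The products `∏_{i < k} G (f_i s)`. -/
def genProd (G : ℂ → ℂ) (k : ℕ) (s : ℂ) : ℂ := ∏ i ∈ Finset.range k, G (mobiusIter i s)

theorem prod_genFactor (G : ℂ → ℂ) (δ : ℝ) (s : ℂ) (k : ℕ) :
    ∏ i ∈ Finset.range k, genFactor G δ s i = genProd G k s * ((((k : ℝ) + 1) ^ δ : ℝ) : ℂ) := by
  induction k with
  | zero => simp [genProd]
  | succ k ih =>
    rw [Finset.prod_range_succ, ih, genProd, genProd, Finset.prod_range_succ, genFactor]
    have : ((((k + 1 : ℕ) : ℝ) + 1) ^ δ : ℝ) =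
        ((k : ℝ) + 1) ^ δ * (1 + 1 / ((k : ℝ) + 1)) ^ δ := by
      rw [← Real.mul_rpow (by positivity) (by positivity)]
      congr 1
      push_cast
      field_simp
    rw [this]
    push_cast
    ring

theorem genProd_eq (G : ℂ → ℂ) (δ : ℝ) (s : ℂ) (k : ℕ) :
    genProd G k s = ((((k : ℝ) + 1) ^ (-δ) : ℝ) : ℂ) *
      ∏ i ∈ Finset.range k, genFactor G δ s i := by
  rw [prod_genFactor, mul_comm, mul_assoc, ← Complex.ofReal_mul,
    ← Real.rpow_add (by positivity)]
  simp

theorem summable_one_div_add_one_sq : Summable fun i : ℕ => (1 / ((i : ℝ) + 1)) ^ 2 := by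
  have := (summable_nat_add_iff 1).2 (Real.summable_one_div_nat_pow.2 one_lt_two)
  simpa [one_div] using this

theorem exists_norm_prod_genFactor_le {G : ℂ → ℂ} {δ : ℝ} (hδ : 1 ≤ δ)
    (hG : HasDriftExpansion G δ) :
    ∃ K : ℝ, ∀ s : ℂ, ‖s‖ ≤ 1 / 2 → ∀ k : ℕ,
      ‖∏ i ∈ Finset.range k, genFactor G δ s i‖ ≤ K := by
  obtain ⟨K, hK0, hK⟩ := exists_norm_genFactor_sub_one_le hδ hG
  refine ⟨Real.exp (∑' i : ℕ, K * (1 / ((i : ℝ) + 1)) ^ 2), fun s hs k => ?_⟩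
  rw [norm_prod]
  calc ∏ i ∈ Finset.range k, ‖genFactor G δ s i‖
      ≤ ∏ i ∈ Finset.range k, (1 + K * (1 / ((i : ℝ) + 1)) ^ 2) := by
        refine Finset.prod_le_prod (fun _ _ => norm_nonneg _) fun i _ => ?_
        have h1 := norm_add_le 1 (genFactor G δ s i - 1)
        rw [norm_one, add_sub_cancel] at h1
        linarith [hK s hs i]
    _ ≤ Real.exp (∑ i ∈ Finset.range k, K * (1 / ((i : ℝ) + 1)) ^ 2) :=
        Real.prod_one_add_le_exp_sum _ fun i => by positivity
    _ ≤ _ := by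
        refine Real.exp_le_exp.2 ((summable_one_div_add_one_sq.mul_left K).sum_le_tsum _ ?_)
        intro i _
        positivity

/-- The infinite product `∏_i G (f_i s) ((i + 2) / (i + 1))^δ`. -/
def genLimit (G : ℂ → ℂ) (δ : ℝ) (s : ℂ) : ℂ := ∏' i, (1 + (genFactor G δ s i - 1))

theorem summable_norm_genFactor_sub_one {G : ℂ → ℂ} {δ : ℝ} (hδ : 1 ≤ δ)
    (hG : HasDriftExpansion G δ) {s : ℂ} (hs : ‖s‖ ≤ 1 / 2) :
    Summable fun i => ‖genFactor G δ s i - 1‖ := by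
  obtain ⟨K, hK0, hK⟩ := exists_norm_genFactor_sub_one_le hδ hG
  exact Summable.of_nonneg_of_le (fun _ => norm_nonneg _) (hK s hs)
    (summable_one_div_add_one_sq.mul_left K)

theorem tendsto_prod_genFactor {G : ℂ → ℂ} {δ : ℝ} (hδ : 1 ≤ δ)
    (hG : HasDriftExpansion G δ) {s : ℂ} (hs : ‖s‖ ≤ 1 / 2) :
    Tendsto (fun k => ∏ i ∈ Finset.range k, genFactor G δ s i) atTop (𝓝 (genLimit G δ s)) := by
  have := (multipliable_one_add_of_summable
    (summable_norm_genFactor_sub_one hδ hG hs)).hasProd.tendsto_prod_nat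
  simpa [genLimit] using this

/-! ### The generating series: asymptotics, bounds and continuity -/

/-- The function `n ↦ ∑_k (∏_{i < k} G (f_i s)) (f_k s)^n`. -/
def genSum (G : ℂ → ℂ) (n : ℕ) (s : ℂ) : ℂ := ∑' k, genProd G k s * mobiusIter k s ^ n

theorem genSum_eq (G : ℂ → ℂ) (δ : ℝ) (s : ℂ) (n : ℕ) :
    genSum G n s = ∑' k : ℕ, ((((k : ℝ) + 1) ^ (-δ) : ℝ) : ℂ) *
      ((∏ i ∈ Finset.range k, genFactor G δ s i) * mobiusIter k s ^ n) := by
  unfold genSum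
  congr 1
  ext k
  rw [genProd_eq G δ]
  ring

theorem tendsto_rpow_mul_genSum {G : ℂ → ℂ} {δ : ℝ} (hδ : 1 < δ)
    (hG : HasDriftExpansion G δ) {s : ℂ} (hs : ‖s‖ ≤ 1 / 2) :
    Tendsto (fun n : ℕ => (((n : ℝ) ^ (δ - 1) : ℝ) : ℂ) * genSum G n s) atTop
      (𝓝 (genLimit G δ s * scalingConst δ)) := by
  obtain ⟨K, hK⟩ := exists_norm_prod_genFactor_le hδ.le hG
  simp_rw [genSum_eq G δ]
  exact tendsto_scaled_tsum hδ (hK s hs) (tendsto_prod_genFactor hδ.le hG hs)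
    (norm_mobiusIter_le hs) (tendsto_mul_one_sub_mobiusIter hs)

theorem exists_norm_rpow_mul_genSum_le {G : ℂ → ℂ} {δ : ℝ} (hδ : 1 < δ)
    (hG : HasDriftExpansion G δ) :
    ∃ D : ℝ, ∀ s : ℂ, ‖s‖ ≤ 1 / 2 → ∀ n : ℕ, 0 < n →
      ‖(((n : ℝ) ^ (δ - 1) : ℝ) : ℂ) * genSum G n s‖ ≤ D := by
  obtain ⟨K, hK⟩ := exists_norm_prod_genFactor_le hδ.le hG
  refine ⟨K * ∫ x in Set.Ioi (0 : ℝ), scaledMajorant δ x, fun s hs n hn => ?_⟩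
  rw [genSum_eq G δ]
  exact norm_scaled_tsum_le hδ (hK s hs) (norm_mobiusIter_le hs) hn

/-- A summable majorant of the products, uniform on the disc of radius `1/2`. -/
theorem exists_summable_norm_genProd_le {G : ℂ → ℂ} {δ : ℝ} (hδ : 1 < δ)
    (hG : HasDriftExpansion G δ) :
    ∃ b : ℕ → ℝ, Summable b ∧ ∀ s : ℂ, ‖s‖ ≤ 1 / 2 → ∀ k, ‖genProd G k s‖ ≤ b k := by
  obtain ⟨K, hK⟩ := exists_norm_prod_genFactor_le hδ.le hG
  have h := (summable_nat_add_iff 1).2 (Real.summable_nat_rpow.2 (by linarith : -δ < -1))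
  refine ⟨_, h.mul_right K, fun s hs k => ?_⟩
  rw [genProd_eq G δ, norm_mul, Complex.norm_real, Real.norm_of_nonneg (by positivity)]
  push_cast
  gcongr
  exact hK s hs k

theorem norm_genProd_mul_pow_le {G : ℂ → ℂ} {b : ℕ → ℝ} {s : ℂ} (hs : ‖s‖ ≤ 1 / 2)
    (hb : ∀ k, ‖genProd G k s‖ ≤ b k) (k n : ℕ) :
    ‖genProd G k s * mobiusIter k s ^ n‖ ≤ b k := by
  rw [norm_mul, norm_pow]
  calc _ ≤ b k * 1 ^ n := by
        have := (norm_nonneg _).trans (hb k)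
        gcongr
        exacts [hb k, norm_mobiusIter_le_one hs k]
    _ = _ := by simp

theorem exists_norm_genSum_le {G : ℂ → ℂ} {δ : ℝ} (hδ : 1 < δ) (hG : HasDriftExpansion G δ) :
    ∃ D : ℝ, ∀ s : ℂ, ‖s‖ ≤ 1 / 2 → ∀ n : ℕ, ‖genSum G n s‖ ≤ D := by
  obtain ⟨b, hbs, hb⟩ := exists_summable_norm_genProd_le hδ hG
  exact ⟨∑' k, b k, fun s hs n => tsum_of_norm_bounded hbs.hasSum
    fun k => norm_genProd_mul_pow_le hs (hb s hs) k n⟩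

theorem continuousOn_genSum {G : ℂ → ℂ} {δ : ℝ} (hδ : 1 < δ) (hG : HasDriftExpansion G δ)
    (hGc : ContinuousOn G (Metric.closedBall 0 1)) (n : ℕ) :
    ContinuousOn (genSum G n) (Metric.closedBall 0 (1 / 2)) := by
  obtain ⟨b, hbs, hb⟩ := exists_summable_norm_genProd_le hδ hG
  refine continuousOn_tsum (fun k => ?_) hbs fun k s hs =>
    norm_genProd_mul_pow_le (by simpa using hs) (hb s (by simpa using hs)) k n
  refine ContinuousOn.mul (continuousOn_finsetProd _ fun i _ => ?_)
    ((continuousOn_mobiusIter k).pow n)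
  refine hGc.comp (continuousOn_mobiusIter i) fun s hs => ?_
  simpa using norm_mobiusIter_le_one (by simpa using hs) i

theorem mobiusIter_zero_arg (k : ℕ) : mobiusIter k 0 = (((k : ℝ) / (k + 1) : ℝ) : ℂ) := by
  have h := one_sub_mobiusIter (s := 0) (by simp) k
  have hk : (k : ℂ) + 1 ≠ 0 := by exact_mod_cast (by positivity : (k : ℝ) + 1 ≠ 0)
  have h2 : mobiusIter k 0 = 1 - (1 - 0) / (1 + k * (1 - 0)) := by rw [← h]; ring
  rw [h2, sub_zero, mul_one, add_comm 1 (k : ℂ)]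
  push_cast
  field_simp
  ring

/-- The orbit of 0 is k/(k + 1), where G is positive. The infinite product is thus a limit of
positive numbers, and it is nonzero because its factors are nonzero with summable deviations from 1.
The resulting H serves as the lower barrier in `exists_harmonic`. -/
theorem exists_genSum_zero_eq {G : ℂ → ℂ} {δ : ℝ} (hδ : 1 < δ) (hG : HasDriftExpansion G δ)
    (hpos : ∀ r : ℝ, 0 ≤ r → r < 1 → ∃ y : ℝ, 0 < y ∧ G r = y) :
    ∃ H : ℕ → ℝ, ∃ c : ℝ, 0 < c ∧ (∀ n, genSum G n 0 = H n) ∧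
      Tendsto (fun n : ℕ => (n : ℝ) ^ (δ - 1) * H n) atTop (𝓝 c) := by
  have hfac : ∀ i : ℕ, ∃ y : ℝ, 0 < y ∧ G (mobiusIter i 0) = y := fun i => by
    rw [mobiusIter_zero_arg]
    exact hpos _ (by positivity) (by rw [div_lt_one (by positivity)]; linarith)
  choose y hy0 hy using hfac
  have hprod : ∀ k, ∏ i ∈ Finset.range k, genFactor G δ 0 i =
      ((∏ i ∈ Finset.range k, (y i * (1 + 1 / ((i : ℝ) + 1)) ^ δ) : ℝ) : ℂ) := fun k => by
    rw [Complex.ofReal_prod]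
    refine Finset.prod_congr rfl fun i _ => ?_
    rw [genFactor, hy]
    push_cast
    rfl
  have hlim := tendsto_prod_genFactor hδ.le hG (s := 0) (by simp)
  have hne : genLimit G δ 0 ≠ 0 := by
    refine tprod_one_add_ne_zero_of_summable (fun i => ?_)
      (summable_norm_genFactor_sub_one hδ.le hG (by simp))
    rw [add_sub_cancel, genFactor, hy, ← Complex.ofReal_mul, Complex.ofReal_ne_zero]
    have := hy0 i
    positivity
  simp_rw [hprod] at hlim
  have hre := (Complex.continuous_re.tendsto _).comp hlim
  have him := (Complex.continuous_im.tendsto _).comp hlim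
  simp only [Function.comp_def, Complex.ofReal_re, Complex.ofReal_im] at hre him
  have him0 : (genLimit G δ 0).im = 0 := tendsto_nhds_unique him tendsto_const_nhds
  have hre0 : 0 ≤ (genLimit G δ 0).re :=
    ge_of_tendsto' hre fun k => Finset.prod_nonneg fun i _ => by
      have := hy0 i
      positivity
  have hre1 : (genLimit G δ 0).re ≠ 0 := fun h => hne (Complex.ext h him0)
  have hH : ∀ n, genSum G n 0 = (((genSum G n 0).re : ℝ) : ℂ) := fun n => by
    have : genSum G n 0 = ((∑' k, (∏ i ∈ Finset.range k, y i) * ((k : ℝ) / (k + 1)) ^ n : ℝ) : ℂ)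
        := by
      rw [Complex.ofReal_tsum]
      refine tsum_congr fun k => ?_
      rw [genProd, mobiusIter_zero_arg]
      simp_rw [hy]
      push_cast
      rfl
    rw [this, Complex.ofReal_re]
  refine ⟨fun n => (genSum G n 0).re, (genLimit G δ 0).re * scalingConst δ,
    mul_pos (lt_of_le_of_ne hre0 hre1.symm) (scalingConst_pos hδ), hH, ?_⟩
  have := (Complex.continuous_re.tendsto _).comp
    (tendsto_rpow_mul_genSum hδ hG (s := 0) (by simp))
  simpa [Function.comp_def, Complex.re_ofReal_mul, Complex.re_mul_ofReal] using this

/-! ### Taylor coefficients as circle integrals -/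

theorem integrable_of_norm_le {E : Type*} [NormedAddCommGroup E] (ν : Measure ℕ)
    [IsFiniteMeasure ν] {φ : ℕ → E} {D : ℝ} (h : ∀ w, ‖φ w‖ ≤ D) : Integrable φ ν :=
  Integrable.of_bound (StronglyMeasurable.of_discrete).aestronglyMeasurable D
    (Eventually.of_forall h)

/-- The `j`-th Taylor coefficient at `0`, as a normalized integral over the circle of
radius `1/2`. -/
def taylorCoef (j : ℕ) (F : ℂ → ℂ) : ℂ :=
  ((2 * Real.pi : ℝ) : ℂ)⁻¹ * ∫ θ in Set.Ioc 0 (2 * Real.pi),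
    F (circleMap 0 (1 / 2) θ) * (circleMap 0 (1 / 2) θ ^ j)⁻¹

theorem norm_circleMap_half (θ : ℝ) : ‖circleMap 0 (1 / 2) θ‖ = 1 / 2 := by
  simp

theorem continuous_circle_weight (j : ℕ) :
    Continuous fun θ : ℝ => (circleMap 0 (1 / 2) θ ^ j)⁻¹ := by
  refine ((continuous_circleMap 0 (1 / 2)).pow j).inv₀ fun θ => pow_ne_zero _ ?_
  exact norm_pos_iff.1 (by rw [norm_circleMap_half]; norm_num)

theorem norm_circle_weight (j : ℕ) (θ : ℝ) : ‖(circleMap 0 (1 / 2) θ ^ j)⁻¹‖ = 2 ^ j := by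
  rw [norm_inv, norm_pow, norm_circleMap_half]
  simp

theorem continuous_comp_circleMap {F : ℂ → ℂ}
    (hF : ContinuousOn F (Metric.closedBall 0 (1 / 2))) :
    Continuous fun θ : ℝ => F (circleMap 0 (1 / 2) θ) :=
  hF.comp_continuous (continuous_circleMap 0 (1 / 2)) fun θ => by
    simp

theorem integrableOn_circle {F : ℂ → ℂ} (hF : ContinuousOn F (Metric.closedBall 0 (1 / 2)))
    (j : ℕ) : IntegrableOn (fun θ => F (circleMap 0 (1 / 2) θ) * (circleMap 0 (1 / 2) θ ^ j)⁻¹)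
      (Set.Ioc 0 (2 * Real.pi)) :=
  (((continuous_comp_circleMap hF).mul (continuous_circle_weight j)).integrableOn_Icc).mono_set
    Set.Ioc_subset_Icc_self

theorem taylorCoef_pow (j v : ℕ) : taylorCoef j (fun s => s ^ v) = if v = j then 1 else 0 := by
  have h1 : (∮ s in C(0, 1 / 2), (s - 0) ^ ((v : ℤ) - j - 1)) =
      Complex.I * ∫ θ in Set.Ioc 0 (2 * Real.pi),
        circleMap 0 (1 / 2) θ ^ v * (circleMap 0 (1 / 2) θ ^ j)⁻¹ := by
    rw [circleIntegral, intervalIntegral.integral_of_le (by positivity), ← integral_const_mul]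
    congr 1
    ext θ
    have h0 : circleMap 0 (1 / 2) θ ≠ 0 :=
      norm_pos_iff.1 (by rw [norm_circleMap_half]; norm_num)
    rw [deriv_circleMap, sub_zero, zpow_sub₀ h0, zpow_sub₀ h0]
    simp only [smul_eq_mul, zpow_natCast, zpow_one]
    field_simp
  have h2 : (∮ s in C(0, 1 / 2), (s - 0) ^ ((v : ℤ) - j - 1)) =
      if v = j then 2 * Real.pi * Complex.I else 0 := by
    split_ifs with h
    · subst h
      have := circleIntegral.integral_sub_center_inv 0 (R := 1 / 2) (by norm_num)
      rw [← this]
      congr 1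
      ext s
      rw [sub_self, zero_sub, zpow_neg_one]
    · exact circleIntegral.integral_sub_zpow_of_ne (by omega) _ _ _
  rw [h2] at h1
  have hpi : (Real.pi : ℂ) ≠ 0 := by exact_mod_cast Real.pi_ne_zero
  unfold taylorCoef
  split_ifs at h1 ⊢ with h
  · have : ∫ θ in Set.Ioc 0 (2 * Real.pi),
        circleMap 0 (1 / 2) θ ^ v * (circleMap 0 (1 / 2) θ ^ j)⁻¹ = 2 * Real.pi := by
      apply mul_left_cancel₀ Complex.I_ne_zero
      rw [← h1]
      ring
    rw [this]
    push_cast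
    field_simp
  · have := (mul_eq_zero.1 h1.symm).resolve_left Complex.I_ne_zero
    rw [this, mul_zero]

theorem taylorCoef_congr {F F' : ℂ → ℂ} (j : ℕ) (h : ∀ s, ‖s‖ ≤ 1 / 2 → F s = F' s) :
    taylorCoef j F = taylorCoef j F' := by
  unfold taylorCoef
  simp_rw [fun θ => h _ (norm_circleMap_half θ).le]

theorem taylorCoef_sub {F F' : ℂ → ℂ} (j : ℕ)
    (hF : ContinuousOn F (Metric.closedBall 0 (1 / 2)))
    (hF' : ContinuousOn F' (Metric.closedBall 0 (1 / 2))) :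
    taylorCoef j (fun s => F s - F' s) = taylorCoef j F - taylorCoef j F' := by
  unfold taylorCoef
  simp_rw [sub_mul]
  rw [integral_sub (integrableOn_circle hF j) (integrableOn_circle hF' j), mul_sub]

theorem taylorCoef_sum {ι : Type*} (I : Finset ι) (a : ι → ℂ) {F : ι → ℂ → ℂ} (j : ℕ)
    (hF : ∀ i, ContinuousOn (F i) (Metric.closedBall 0 (1 / 2))) :
    taylorCoef j (fun s => ∑ i ∈ I, a i * F i s) = ∑ i ∈ I, a i * taylorCoef j (F i) := by
  unfold taylorCoef
  simp_rw [Finset.sum_mul, mul_assoc]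
  rw [integral_finsetSum _ fun i _ => (integrableOn_circle (hF i) j).const_mul (a i),
    Finset.mul_sum]
  refine Finset.sum_congr rfl fun i _ => ?_
  rw [integral_const_mul]
  ring

theorem norm_taylorCoef_le {F : ℂ → ℂ} {D : ℝ} (j : ℕ) (hF : ∀ s, ‖s‖ ≤ 1 / 2 → ‖F s‖ ≤ D) :
    ‖taylorCoef j F‖ ≤ D * 2 ^ j := by
  unfold taylorCoef
  have h1 := norm_setIntegral_le_of_norm_le_const (μ := volume) (s := Set.Ioc 0 (2 * Real.pi))
    (f := fun θ => F (circleMap 0 (1 / 2) θ) * (circleMap 0 (1 / 2) θ ^ j)⁻¹) (C := D * 2 ^ j)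
    (by rw [Real.volume_Ioc]; exact ENNReal.ofReal_lt_top) (fun θ _ => by
      rw [norm_mul, norm_circle_weight]
      gcongr
      exact hF _ (norm_circleMap_half θ).le)
  have h2 : volume.real (Set.Ioc 0 (2 * Real.pi)) = 2 * Real.pi := by
    rw [Real.volume_real_Ioc_of_le (by positivity), sub_zero]
  rw [h2] at h1
  rw [norm_mul, norm_inv, Complex.norm_real, Real.norm_of_nonneg (by positivity)]
  rw [inv_mul_le_iff₀ (by positivity)]
  linarith

theorem tendsto_taylorCoef {F : ℕ → ℂ → ℂ} {F' : ℂ → ℂ} {D : ℝ} (j : ℕ)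
    (hc : ∀ n, ContinuousOn (F n) (Metric.closedBall 0 (1 / 2)))
    (hb : ∀ᶠ n in atTop, ∀ s, ‖s‖ ≤ 1 / 2 → ‖F n s‖ ≤ D)
    (hl : ∀ s, ‖s‖ ≤ 1 / 2 → Tendsto (fun n => F n s) atTop (𝓝 (F' s))) :
    Tendsto (fun n => taylorCoef j (F n)) atTop (𝓝 (taylorCoef j F')) := by
  refine Tendsto.const_mul _ ?_
  refine tendsto_integral_filter_of_dominated_convergence (fun _ => D * 2 ^ j) ?_ ?_ ?_ ?_
  · exact Eventually.of_forall fun n => (integrableOn_circle (hc n) j).aestronglyMeasurable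
  · filter_upwards [hb] with n hn
    refine Eventually.of_forall fun θ => ?_
    rw [norm_mul, norm_circle_weight]
    gcongr
    exact hn _ (norm_circleMap_half θ).le
  · exact integrable_const _
  · exact Eventually.of_forall fun θ => (hl _ (norm_circleMap_half θ).le).mul_const _

theorem continuousOn_integral_nat (ν : Measure ℕ) [IsFiniteMeasure ν] {F : ℕ → ℂ → ℂ} {D r : ℝ}
    (hc : ∀ n, ContinuousOn (F n) (Metric.closedBall 0 r))
    (hb : ∀ s, ‖s‖ ≤ r → ∀ n, ‖F n s‖ ≤ D) :
    ContinuousOn (fun s => ∫ w, F w s ∂ν) (Metric.closedBall 0 r) := by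
  refine continuousOn_of_dominated (bound := fun _ => D) ?_ ?_ (integrable_const _) ?_
  · exact fun s _ => (StronglyMeasurable.of_discrete).aestronglyMeasurable
  · exact fun s hs => Eventually.of_forall fun w => hb s (by simpa using hs) w
  · exact Eventually.of_forall fun w => hc w

theorem integral_taylorCoef (ν : Measure ℕ) [IsFiniteMeasure ν] {F : ℕ → ℂ → ℂ} {D : ℝ} (j : ℕ)
    (hc : ∀ n, ContinuousOn (F n) (Metric.closedBall 0 (1 / 2)))
    (hb : ∀ s, ‖s‖ ≤ 1 / 2 → ∀ n, ‖F n s‖ ≤ D) :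
    ∫ w, taylorCoef j (F w) ∂ν = taylorCoef j (fun s => ∫ w, F w s ∂ν) := by
  unfold taylorCoef
  rw [integral_const_mul]
  congr 1
  rw [integral_integral_swap]
  · simp_rw [integral_mul_const]
  · refine Integrable.of_bound (C := D * 2 ^ j) ?_ (Eventually.of_forall ?_)
    · refine Measurable.aestronglyMeasurable ?_
      refine measurable_from_prod_countable_right fun n => ?_
      exact ((continuous_comp_circleMap (hc n)).mul (continuous_circle_weight j)).measurable
    · rintro ⟨n, θ⟩
      simp only [Function.uncurry]
      rw [norm_mul, norm_circle_weight]
      gcongr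
      exact hb _ (norm_circleMap_half θ).le n

/-! ### Action of the kernel on the generating series and its coefficients -/

theorem integral_genSum (ν : Measure ℕ) [IsFiniteMeasure ν] {G : ℂ → ℂ} {δ : ℝ} (hδ : 1 < δ)
    (hG : HasDriftExpansion G δ) {s : ℂ} (hs : ‖s‖ ≤ 1 / 2) :
    HasSum (fun k => genProd G k s * ∫ w, mobiusIter k s ^ w ∂ν) (∫ w, genSum G w s ∂ν) := by
  obtain ⟨b, hbs, hb⟩ := exists_summable_norm_genProd_le hδ hG
  have hle := norm_genProd_mul_pow_le hs (hb s hs)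
  have h := hasSum_integral_of_summable_integral_norm (μ := ν)
    (F := fun k w => genProd G k s * mobiusIter k s ^ w)
    (fun k => integrable_of_norm_le ν (hle k)) ?_
  · simp_rw [integral_const_mul] at h
    exact h
  · refine Summable.of_nonneg_of_le (fun k => integral_nonneg fun _ => norm_nonneg _) (fun k => ?_)
      (hbs.mul_right (ν.real Set.univ))
    calc ∫ w, ‖genProd G k s * mobiusIter k s ^ w‖ ∂ν ≤ ∫ _, b k ∂ν := by
          refine integral_mono (integrable_of_norm_le ν (hle k)).norm (integrable_const _) (hle k)
      _ = _ := by simp [mul_comm]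

/-- A finite linear combination of laws on `ℕ` whose generating function is `G z (2 - z)^{-v}`
maps `n ↦ genSum G n s` to its value at `v`, up to the source term `s ^ v`. -/
theorem sum_mul_integral_genSum {ι : Type*} (I : Finset ι) (a : ι → ℂ) (ν : ι → Measure ℕ)
    [∀ i, IsFiniteMeasure (ν i)] {G : ℂ → ℂ} {δ : ℝ} (hδ : 1 < δ)
    (hG : HasDriftExpansion G δ) {v : ℕ}
    (hgf : ∀ z, ‖z‖ ≤ 1 → ∑ i ∈ I, a i * ∫ w, z ^ w ∂ν i = G z * (1 / (2 - z)) ^ v)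
    {s : ℂ} (hs : ‖s‖ ≤ 1 / 2) :
    ∑ i ∈ I, a i * ∫ w, genSum G w s ∂ν i = genSum G v s - s ^ v := by
  have h1 : HasSum (fun k => ∑ i ∈ I, a i * (genProd G k s * ∫ w, mobiusIter k s ^ w ∂ν i))
      (∑ i ∈ I, a i * ∫ w, genSum G w s ∂ν i) :=
    hasSum_sum fun i _ => (integral_genSum (ν i) hδ hG hs).mul_left (a i)
  -- The factor G(f_k(s)) lengthens the product and 1/(2 - f_k(s)) is the next iterate, so the sum
  -- is shifted by one; the missing k = 0 term is the source s^v.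
  have h2 : ∀ k, ∑ i ∈ I, a i * (genProd G k s * ∫ w, mobiusIter k s ^ w ∂ν i) =
      genProd G (k + 1) s * mobiusIter (k + 1) s ^ v := fun k => by
    have := hgf _ (norm_mobiusIter_le_one hs k)
    calc _ = genProd G k s * ∑ i ∈ I, a i * ∫ w, mobiusIter k s ^ w ∂ν i := by
          rw [Finset.mul_sum]
          exact Finset.sum_congr rfl fun i _ => by ring
      _ = _ := by
          rw [this, genProd, genProd, Finset.prod_range_succ, mobiusIter]
          ring
  simp_rw [h2] at h1
  obtain ⟨b, hbs, hb⟩ := exists_summable_norm_genProd_le hδ hG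
  have h3 : Summable fun k => genProd G k s * mobiusIter k s ^ v :=
    Summable.of_norm_bounded hbs fun k => norm_genProd_mul_pow_le hs (hb s hs) k v
  rw [← h1.tsum_eq, genSum, h3.tsum_eq_zero_add]
  simp [genProd, mobiusIter]

/-- The real part of the `j`-th Taylor coefficient of `s ↦ genSum G n s`. -/
def genCoef (G : ℂ → ℂ) (j n : ℕ) : ℝ := (taylorCoef j (genSum G n)).re

theorem exists_abs_genCoef_le {G : ℂ → ℂ} {δ : ℝ} (hδ : 1 < δ) (hG : HasDriftExpansion G δ)
    (j : ℕ) : ∃ D : ℝ, ∀ n, ‖genCoef G j n‖ ≤ D := by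
  obtain ⟨D, hD⟩ := exists_norm_genSum_le hδ hG
  exact ⟨D * 2 ^ j, fun n => (Complex.abs_re_le_norm _).trans
    (norm_taylorCoef_le j fun s hs => hD s hs n)⟩

/-- Extracting a coefficient turns the source s^v into a point source at v = j. Real weights a_i
allow signed combinations of laws, needed below level M. -/
theorem sum_mul_integral_genCoef {ι : Type*} (I : Finset ι) (a : ι → ℝ) (ν : ι → Measure ℕ)
    [∀ i, IsFiniteMeasure (ν i)] {G : ℂ → ℂ} {δ : ℝ} (hδ : 1 < δ)
    (hG : HasDriftExpansion G δ) (hGc : ContinuousOn G (Metric.closedBall 0 1)) {v : ℕ}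
    (hgf : ∀ z, ‖z‖ ≤ 1 → ∑ i ∈ I, (a i : ℂ) * ∫ w, z ^ w ∂ν i = G z * (1 / (2 - z)) ^ v)
    (j : ℕ) :
    ∑ i ∈ I, a i * ∫ w, genCoef G j w ∂ν i = genCoef G j v - if v = j then 1 else 0 := by
  obtain ⟨D, hD⟩ := exists_norm_genSum_le hδ hG
  have hc := continuousOn_genSum hδ hG hGc
  have h1 : ∀ i, ∫ w, genCoef G j w ∂ν i =
      (taylorCoef j (fun s => ∫ w, genSum G w s ∂ν i)).re := fun i => by
    rw [← integral_taylorCoef (ν i) j hc hD]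
    exact integral_re (𝕜 := ℂ) (integrable_of_norm_le (ν i)
      fun w => norm_taylorCoef_le j fun s hs => hD s hs w)
  have h2 : ∑ i ∈ I, (a i : ℂ) * taylorCoef j (fun s => ∫ w, genSum G w s ∂ν i) =
      taylorCoef j (genSum G v) - if v = j then 1 else 0 := by
    rw [← taylorCoef_pow j v, ← taylorCoef_sub j (hc v) (continuous_pow v).continuousOn,
      ← taylorCoef_sum I (fun i => (a i : ℂ)) j
        fun i => continuousOn_integral_nat (ν i) hc hD]
    exact taylorCoef_congr j fun s hs => sum_mul_integral_genSum I _ ν hδ hG hgf hs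
  have h3 := congrArg Complex.re h2
  rw [Complex.re_sum] at h3
  simp_rw [h1]
  simp only [Complex.re_ofReal_mul, Complex.sub_re] at h3
  rw [h3, genCoef]
  split_ifs <;> simp

/-- Dominated convergence on the circle; nothing is claimed about the sign of the limit. -/
theorem exists_tendsto_rpow_mul_genCoef {G : ℂ → ℂ} {δ : ℝ} (hδ : 1 < δ)
    (hG : HasDriftExpansion G δ) (hGc : ContinuousOn G (Metric.closedBall 0 1)) (j : ℕ) :
    ∃ L : ℝ, Tendsto (fun n : ℕ => (n : ℝ) ^ (δ - 1) * genCoef G j n) atTop (𝓝 L) := by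
  obtain ⟨D, hD⟩ := exists_norm_rpow_mul_genSum_le hδ hG
  have hc := continuousOn_genSum hδ hG hGc
  have h := tendsto_taylorCoef (F := fun n s => (((n : ℝ) ^ (δ - 1) : ℝ) : ℂ) * genSum G n s)
    (D := D) j (fun n => continuousOn_const.mul (hc n))
    ((eventually_gt_atTop 0).mono fun n hn s hs => hD s hs n hn)
    (fun s hs => tendsto_rpow_mul_genSum hδ hG hs)
  refine ⟨_, ((Complex.continuous_re.tendsto _).comp h).congr fun n => ?_⟩
  have h1 := taylorCoef_sum {()} (fun _ => (((n : ℝ) ^ (δ - 1) : ℝ) : ℂ))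
    (F := fun _ => genSum G n) j (fun _ => hc n)
  simp only [Finset.sum_singleton] at h1
  simp only [Function.comp]
  rw [h1, Complex.re_ofReal_mul, genCoef]

/-! ### Second-order expansion of generating functions at 1 -/

theorem norm_pow_sub_le {z : ℂ} (hz : ‖z‖ ≤ 1) (w : ℕ) :
    ‖z ^ w - (1 - w * (1 - z))‖ ≤ (w : ℝ) ^ 2 * ‖1 - z‖ ^ 2 := by
  induction w with
  | zero => simp
  | succ w ih =>
    have h : z ^ (w + 1) - (1 - ((w + 1 : ℕ) : ℂ) * (1 - z)) =
        z * (z ^ w - (1 - w * (1 - z))) + w * (1 - z) ^ 2 := by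
      push_cast
      ring
    rw [h]
    refine (norm_add_le _ _).trans ?_
    rw [norm_mul, norm_mul, norm_pow, Complex.norm_natCast]
    have h1 : ‖z‖ * ‖z ^ w - (1 - w * (1 - z))‖ ≤ 1 * ((w : ℝ) ^ 2 * ‖1 - z‖ ^ 2) := by gcongr
    have h2 : 0 ≤ ‖1 - z‖ ^ 2 := by positivity
    have hw : (0 : ℝ) ≤ w := Nat.cast_nonneg w
    push_cast
    nlinarith

theorem exists_norm_one_add_pow_sub_le (m : ℕ) :
    ∃ K : ℝ, 0 ≤ K ∧ ∀ x : ℂ, ‖x‖ ≤ 2 → ‖(1 + x) ^ m - (1 + m * x)‖ ≤ K * ‖x‖ ^ 2 := by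
  induction m with
  | zero => exact ⟨0, le_rfl, fun x _ => by simp⟩
  | succ m ih =>
    obtain ⟨K, hK0, hK⟩ := ih
    refine ⟨3 * K + m, by positivity, fun x hx => ?_⟩
    have h : (1 + x) ^ (m + 1) - (1 + ((m + 1 : ℕ) : ℂ) * x) =
        (1 + x) * ((1 + x) ^ m - (1 + m * x)) + m * x ^ 2 := by
      push_cast
      ring
    rw [h]
    refine (norm_add_le _ _).trans ?_
    rw [norm_mul, norm_mul, norm_pow, Complex.norm_natCast]
    have h0 : ‖1 + x‖ ≤ 3 := (norm_add_le _ _).trans (by rw [norm_one]; linarith)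
    calc _ ≤ 3 * (K * ‖x‖ ^ 2) + m * ‖x‖ ^ 2 := by
          gcongr
          exact hK x hx
      _ = _ := by ring

/-- The probability generating function of a law on `ℕ`. -/
def pgf (ν : Measure ℕ) (z : ℂ) : ℂ := ∫ w, z ^ w ∂ν

theorem norm_pow_le_one_of_norm_le_one {z : ℂ} (hz : ‖z‖ ≤ 1) (w : ℕ) : ‖z ^ w‖ ≤ 1 := by
  rw [norm_pow]
  exact pow_le_one₀ (norm_nonneg _) hz

theorem continuousOn_pgf (ν : Measure ℕ) [IsFiniteMeasure ν] :
    ContinuousOn (pgf ν) (Metric.closedBall 0 1) :=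
  continuousOn_integral_nat ν (F := fun w z => z ^ w) (D := 1)
    (fun n => (continuous_pow n).continuousOn) fun _ hs n => norm_pow_le_one_of_norm_le_one hs n

theorem norm_pgf_sub_le (ν : Measure ℕ) [IsProbabilityMeasure ν]
    (h2 : Integrable (fun w : ℕ => (w : ℝ) ^ 2) ν) {z : ℂ} (hz : ‖z‖ ≤ 1) :
    ‖pgf ν z - (1 - ((∫ w, (w : ℝ) ∂ν : ℝ) : ℂ) * (1 - z))‖ ≤
      (∫ w, (w : ℝ) ^ 2 ∂ν) * ‖1 - z‖ ^ 2 := by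
  have h1 : Integrable (fun w : ℕ => (w : ℝ)) ν := by
    refine h2.mono' (StronglyMeasurable.of_discrete).aestronglyMeasurable
      (Eventually.of_forall fun w => ?_)
    rw [Real.norm_of_nonneg (Nat.cast_nonneg w)]
    rcases Nat.eq_zero_or_pos w with rfl | hw
    · simp
    · have : (1 : ℝ) ≤ w := by exact_mod_cast hw
      nlinarith
  have h3 : Integrable (fun w : ℕ => z ^ w) ν :=
    integrable_of_norm_le ν (norm_pow_le_one_of_norm_le_one hz)
  have h4 : Integrable (fun w : ℕ => (1 : ℂ) - (w : ℂ) * (1 - z)) ν := by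
    refine (integrable_const _).sub (Integrable.mul_const ?_ _)
    simpa using h1.ofReal (𝕜 := ℂ)
  have h5 : pgf ν z - (1 - ((∫ w, (w : ℝ) ∂ν : ℝ) : ℂ) * (1 - z)) =
      ∫ w : ℕ, (z ^ w - (1 - w * (1 - z))) ∂ν := by
    rw [integral_sub h3 h4, integral_sub (integrable_const _), integral_mul_const, pgf,
      ← integral_complex_ofReal]
    · simp
    · refine Integrable.mul_const ?_ _
      simpa using h1.ofReal (𝕜 := ℂ)
  rw [h5, ← integral_mul_const]
  exact norm_integral_le_of_norm_le (h2.mul_const _)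
    (Eventually.of_forall fun w => norm_pow_sub_le hz w)

/-- To first order the generating function contributes -(M + δ)(1 - z) and (2 - z)^M contributes
+M(1 - z), so the drift δ remains. -/
theorem hasDriftExpansion_pgf_mul (ν : Measure ℕ) [IsProbabilityMeasure ν] {M : ℕ} {δ : ℝ}
    (h2 : Integrable (fun w : ℕ => (w : ℝ) ^ 2) ν) (h1 : ∫ w, (w : ℝ) ∂ν = M + δ) :
    HasDriftExpansion (fun z => pgf ν z * (2 - z) ^ M) δ := by
  obtain ⟨K, hK0, hK⟩ := exists_norm_one_add_pow_sub_le M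
  set K₂ := ∫ w, (w : ℝ) ^ 2 ∂ν with hK₂
  have hK₂0 : 0 ≤ K₂ := integral_nonneg fun w => by positivity
  refine ⟨|(M + δ) * M| + K₂ * 3 ^ M + K * (1 + |M + δ| * 2), fun z hz => ?_⟩
  set x := 1 - z with hx
  have hx2 : ‖x‖ ≤ 2 := (norm_sub_le _ _).trans (by rw [norm_one]; linarith)
  have ha := norm_pgf_sub_le ν h2 hz
  rw [h1, ← hx, ← hK₂] at ha
  have hb := hK x hx2
  have hz2 : 2 - z = 1 + x := by rw [hx]; ring
  have hpow : ‖(1 + x) ^ M‖ ≤ 3 ^ M := by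
    rw [norm_pow]
    gcongr
    exact (norm_add_le _ _).trans (by rw [norm_one]; linarith)
  have hlin : ‖(1 : ℂ) - ((M + δ : ℝ) : ℂ) * x‖ ≤ 1 + |M + δ| * 2 := by
    refine (norm_sub_le _ _).trans ?_
    rw [norm_one, norm_mul, Complex.norm_real, Real.norm_eq_abs]
    gcongr
  have key : pgf ν z * (2 - z) ^ M - (1 - δ * x) =
      -((((M + δ) * M : ℝ) : ℂ) * x ^ 2) +
      (pgf ν z - (1 - ((M + δ : ℝ) : ℂ) * x)) * (1 + x) ^ M +
      ((1 + x) ^ M - (1 + M * x)) * (1 - ((M + δ : ℝ) : ℂ) * x) := by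
    rw [hz2]
    push_cast
    ring
  rw [key]
  refine norm_add₃_le.trans ?_
  rw [norm_neg, norm_mul, norm_mul, norm_mul, norm_pow, Complex.norm_real, Real.norm_eq_abs]
  calc _ ≤ |(M + δ) * M| * ‖x‖ ^ 2 + K₂ * ‖x‖ ^ 2 * 3 ^ M +
        K * ‖x‖ ^ 2 * (1 + |M + δ| * 2) := by gcongr
    _ = _ := by ring

/-! ### Maximum principle and construction of the harmonic function -/

/-- Since f decays, a positive value would force a positive maximum, attained at some v ≥ N.
Harmonicity there makes f equal to its maximum κ_v-almost everywhere, in particular at the charged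
point 0, where f ≤ 0. -/
theorem le_zero_of_harmonic {κ : ℕ → Measure ℕ} [∀ v, IsProbabilityMeasure (κ v)]
    (hκ : ∀ v, κ v {0} ≠ 0) {f : ℕ → ℝ} (hf : Tendsto f atTop (𝓝 0)) {N : ℕ} (hN : 0 < N)
    (hb : ∀ v < N, f v ≤ 0) (hh : ∀ v, N ≤ v → ∫ w, f w ∂κ v = f v) : ∀ v, f v ≤ 0 := by
  by_contra! hcon
  obtain ⟨v₀, hv₀⟩ := hcon
  obtain ⟨K, hK⟩ := eventually_atTop.1 (hf.eventually (gt_mem_nhds hv₀))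
  obtain ⟨v, -, hv⟩ := Finset.exists_max_image (Finset.range (K + v₀ + 1)) f ⟨v₀, by simp⟩
  have hmax : ∀ w, f w ≤ f v := fun w => by
    rcases lt_or_ge w (K + v₀ + 1) with hw | hw
    · exact hv w (by simpa using hw)
    · exact (hK w (by omega)).le.trans (hv v₀ (by simp))
  have hpos : 0 < f v := hv₀.trans_le (hmax v₀)
  have hNv : N ≤ v := by
    by_contra! h
    exact absurd (hb v h) (not_le.2 hpos)
  obtain ⟨D, hD⟩ : ∃ D, ∀ w, ‖f w‖ ≤ D := by
    obtain ⟨D, hD⟩ := (hf.norm.bddAbove_range)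
    exact ⟨D, fun w => hD ⟨w, rfl⟩⟩
  have hint : Integrable f (κ v) := integrable_of_norm_le _ hD
  have h0 : ∫ w, (f v - f w) ∂κ v = 0 := by
    rw [integral_sub (integrable_const _) hint, hh v hNv]
    simp
  have h1 := (integral_eq_zero_iff_of_nonneg (fun w => sub_nonneg.2 (hmax w))
    ((integrable_const _).sub hint)).1 h0
  have h2 : f v - f 0 = 0 := by
    by_contra h
    refine hκ v (measure_mono_null ?_ (ae_iff.1 h1))
    intro w hw
    rw [Set.mem_singleton_iff] at hw
    subst hw
    exact h
  linarith [hb 0 hN]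

theorem pos_of_harmonic_of_nonneg {ν : Measure ℕ} [IsProbabilityMeasure ν] (hν : ν {0} ≠ 0)
    {f : ℕ → ℝ} (hf : ∀ w, 0 ≤ f w) (hfi : Integrable f ν) (h0 : 0 < f 0) :
    0 < ∫ w, f w ∂ν := by
  rw [integral_pos_iff_support_of_nonneg hf hfi]
  refine lt_of_lt_of_le (pos_iff_ne_zero.2 hν) (measure_mono ?_)
  intro w hw
  rw [Set.mem_singleton_iff] at hw
  subst hw
  exact h0.ne'

theorem tendsto_zero_of_rpow_mul {δ : ℝ} (hδ : 1 < δ) {f : ℕ → ℝ} {L : ℝ}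
    (h : Tendsto (fun n : ℕ => (n : ℝ) ^ (δ - 1) * f n) atTop (𝓝 L)) :
    Tendsto f atTop (𝓝 0) := by
  have h1 : Tendsto (fun n : ℕ => (n : ℝ) ^ (-(δ - 1))) atTop (𝓝 0) :=
    (tendsto_rpow_neg_atTop (by linarith)).comp tendsto_natCast_atTop_atTop
  have h2 := h1.mul h
  rw [zero_mul] at h2
  refine h2.congr' ?_
  filter_upwards [eventually_gt_atTop 0] with n hn
  have hn' : (0 : ℝ) < n := by exact_mod_cast hn
  rw [← mul_assoc, ← Real.rpow_add hn']
  simp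

theorem exists_harmonic {κ : ℕ → Measure ℕ} [∀ v, IsProbabilityMeasure (κ v)]
    (hκ : ∀ v, κ v {0} ≠ 0) {M : ℕ} (hM : 0 < M) {δ : ℝ} (hδ : 1 < δ)
    (h2 : Integrable (fun w : ℕ => (w : ℝ) ^ 2) (κ M)) (h1 : ∫ w, (w : ℝ) ∂κ M = M + δ)
    (hgf : ∀ v, M ≤ v → ∀ z, ‖z‖ ≤ 1 → pgf (κ v) z = pgf (κ M) z * (1 / (2 - z)) ^ (v - M)) :
    ∃ u : ℕ → ℝ, u 0 = 1 ∧ Tendsto u atTop (𝓝 0) ∧ (∀ v, 0 < v → ∫ w, u w ∂κ v = u v) ∧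
      ∃ c : ℝ, 0 < c ∧ Tendsto (fun n : ℕ => (n : ℝ) ^ (δ - 1) * u n) atTop (𝓝 c) := by
  set G : ℂ → ℂ := fun z => pgf (κ M) z * (2 - z) ^ M with hGdef
  have hG : HasDriftExpansion G δ := hasDriftExpansion_pgf_mul _ h2 h1
  have hGc : ContinuousOn G (Metric.closedBall 0 1) :=
    (continuousOn_pgf _).mul (by fun_prop)
  have hGpos : ∀ r : ℝ, 0 ≤ r → r < 1 → ∃ y : ℝ, 0 < y ∧ G r = y := fun r hr hr1 => by
    refine ⟨(∫ w, r ^ w ∂κ M) * (2 - r) ^ M, mul_pos ?_ (pow_pos (by linarith) _), ?_⟩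
    · refine pos_of_harmonic_of_nonneg (hκ M) (fun w => by positivity)
        (integrable_of_norm_le _ (D := 1) fun w => ?_) (by simp)
      rw [Real.norm_of_nonneg (by positivity)]
      exact pow_le_one₀ hr hr1.le
    · rw [hGdef]
      push_cast
      congr 1
      rw [pgf, ← integral_complex_ofReal]
      push_cast
      rfl
  -- the kernel above level `M`
  have hgfv : ∀ v, M ≤ v → ∀ z : ℂ, ‖z‖ ≤ 1 →
      ∑ i ∈ ({()} : Finset Unit), (((fun _ => 1 : Unit → ℝ) i : ℝ) : ℂ) * ∫ w, z ^ w ∂κ v =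
        G z * (1 / (2 - z)) ^ v := fun v hv z hz => by
    have h0 := two_sub_ne_zero_of_norm_le_one hz
    have := hgf v hv z hz
    obtain ⟨m, rfl⟩ := Nat.exists_eq_add_of_le hv
    rw [Nat.add_sub_cancel_left, pgf] at this
    simp only [Finset.sum_singleton, Complex.ofReal_one, one_mul]
    rw [this, hGdef]
    simp only
    rw [pow_add, one_div, inv_pow, inv_pow]
    field_simp
  have hupper : ∀ v, M ≤ v → ∀ j, ∫ w, genCoef G j w ∂κ v =
      genCoef G j v - if v = j then 1 else 0 := fun v hv j => by
    have := sum_mul_integral_genCoef _ (fun _ => (1 : ℝ)) (fun _ : Unit => κ v) hδ hG hGc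
      (hgfv v hv) j
    simpa using this
  -- For v < M the function G(z)(2 - z)^{-v} = pgf(κ_M)(z)(2 - z)^{M-v} need not be the generating
  -- function of κ_v. Expanding the binomial still makes it a signed combination of generating
  -- functions of shifts of κ_M, which detects the source at v.
  have hlower : ∀ v, v < M → ∃ a : ℕ → ℝ, ∀ j,
      ∑ i ∈ Finset.range (M - v + 1), a i * ∫ w, genCoef G j (w + i) ∂κ M =
        genCoef G j v - if v = j then 1 else 0 := fun v hv => by
    refine ⟨fun i => (-1) ^ i * 2 ^ (M - v - i) * ((M - v).choose i : ℝ), fun j => ?_⟩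
    have hmap : ∀ i : ℕ, IsFiniteMeasure ((κ M).map fun w => w + i) := fun i => inferInstance
    have hE : ∀ (E : Type) [NormedAddCommGroup E] [NormedSpace ℝ E] (φ : ℕ → E) (i : ℕ),
        ∫ w, φ w ∂((κ M).map fun w => w + i) = ∫ w, φ (w + i) ∂κ M := fun E _ _ φ i =>
      integral_map (Measurable.of_discrete).aemeasurable
        (StronglyMeasurable.of_discrete).aestronglyMeasurable
    have := sum_mul_integral_genCoef (v := v) (Finset.range (M - v + 1))
      (fun i => (-1) ^ i * 2 ^ (M - v - i) * ((M - v).choose i : ℝ))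
      (fun i => (κ M).map fun w => w + i) hδ hG hGc ?_ j
    · simp_rw [hE] at this
      exact this
    · intro z hz
      have h0 := two_sub_ne_zero_of_norm_le_one hz
      simp_rw [hE, pow_add, integral_mul_const]
      have hb : (2 - z) ^ (M - v) = ∑ i ∈ Finset.range (M - v + 1),
          (-z) ^ i * 2 ^ (M - v - i) * ((M - v).choose i : ℂ) := by
        rw [← add_pow]; congr 1; ring
      have hc : G z * (1 / (2 - z)) ^ v = pgf (κ M) z * (2 - z) ^ (M - v) := by
        rw [hGdef]
        obtain ⟨m, rfl⟩ := Nat.exists_eq_add_of_lt hv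
        simp only
        rw [show v + m + 1 - v = m + 1 by omega, show v + m + 1 = v + (m + 1) by ring, pow_add,
          one_div, inv_pow]
        field_simp
      rw [hc, hb, Finset.mul_sum]
      refine Finset.sum_congr rfl fun i _ => ?_
      rw [pgf, neg_pow]
      push_cast
      ring
  -- the decaying functions
  have hWb := exists_abs_genCoef_le hδ hG
  choose D hD using hWb
  choose L hL using exists_tendsto_rpow_mul_genCoef hδ hG hGc
  have hint : ∀ (ν : Measure ℕ) [IsProbabilityMeasure ν] (j : ℕ), Integrable (genCoef G j) ν :=
    fun ν _ j => integrable_of_norm_le ν (hD j)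
  let U : (Fin M → ℝ) → ℕ → ℝ := fun c n => ∑ j : Fin M, c j * genCoef G j n
  have hUint : ∀ (ν : Measure ℕ) [IsProbabilityMeasure ν] (c : Fin M → ℝ),
      ∫ w, U c w ∂ν = ∑ j : Fin M, c j * ∫ w, genCoef G j w ∂ν := fun ν _ c => by
    rw [integral_finsetSum _ fun (j : Fin M) _ => (hint ν j).const_mul (c j)]
    simp_rw [integral_const_mul]
  have hUL : ∀ c, Tendsto (fun n : ℕ => (n : ℝ) ^ (δ - 1) * U c n) atTop
      (𝓝 (∑ j : Fin M, c j * L j)) := fun c => by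
    have : (fun n : ℕ => (n : ℝ) ^ (δ - 1) * U c n) =
        fun n : ℕ => ∑ j : Fin M, c j * ((n : ℝ) ^ (δ - 1) * genCoef G j n) := by
      ext n
      rw [Finset.mul_sum]
      exact Finset.sum_congr rfl fun j _ => by ring
    rw [this]
    exact tendsto_finsetSum _ fun j _ => (hL j).const_mul _
  have hU0 : ∀ c, Tendsto (U c) atTop (𝓝 0) := fun c => tendsto_zero_of_rpow_mul hδ (hUL c)
  have hUup : ∀ c v, M ≤ v → ∫ w, U c w ∂κ v = U c v := fun c v hv => by
    rw [hUint]
    refine Finset.sum_congr rfl fun j _ => ?_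
    rw [hupper v hv, if_neg (by have := j.2; omega), sub_zero]
  -- the linear system for the boundary conditions
  let A : Matrix (Fin M) (Fin M) ℝ := fun v j =>
    if (v : ℕ) = 0 then genCoef G j v else genCoef G j v - ∫ w, genCoef G j w ∂κ v
  have hA : ∀ c v, A.mulVec c v =
      if (v : ℕ) = 0 then U c v else U c v - ∫ w, U c w ∂κ v := fun c v => by
    simp only [Matrix.mulVec, dotProduct, A]
    split_ifs with h
    · exact Finset.sum_congr rfl fun j _ => mul_comm _ _
    · rw [hUint, ← Finset.sum_sub_distrib]
      exact Finset.sum_congr rfl fun j _ => by ring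
  -- A kernel vector c yields a decaying function, harmonic off 0 and zero at 0; the maximum
  -- principle applied to both signs annihilates it. Then `hlower` recovers each c_v from the zero
  -- function, so c = 0.
  have hinj : Function.Injective A.mulVecLin := by
    rw [← LinearMap.ker_eq_bot, LinearMap.ker_eq_bot']
    intro c hc
    have hc' : ∀ v : Fin M, (if (v : ℕ) = 0 then U c v else U c v - ∫ w, U c w ∂κ v) = 0 :=
      fun v => by rw [← hA]; exact congrFun hc v
    have hz : U c 0 = 0 := by simpa using hc' ⟨0, hM⟩
    have hharm : ∀ v, 1 ≤ v → ∫ w, U c w ∂κ v = U c v := fun v hv => by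
      rcases lt_or_ge v M with h | h
      · have := hc' ⟨v, h⟩
        rw [if_neg (by simp; omega)] at this
        simp only at this
        linarith
      · exact hUup c v h
    have hle := le_zero_of_harmonic hκ (hU0 c) one_pos
      (fun v hv => by rw [Nat.lt_one_iff.1 hv, hz]) hharm
    have hge := le_zero_of_harmonic hκ (f := fun v => -U c v) (by simpa using (hU0 c).neg)
      one_pos (fun v hv => by rw [Nat.lt_one_iff.1 hv, hz, neg_zero])
      (fun v hv => by rw [integral_neg, hharm v hv])
    have hUz : ∀ v, U c v = 0 := fun v => le_antisymm (hle v) (by linarith [hge v])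
    ext v
    obtain ⟨a, ha⟩ := hlower v v.2
    have h3 : ∑ j : Fin M, c j * ∑ i ∈ Finset.range (M - v + 1),
        a i * ∫ w, genCoef G j (w + i) ∂κ M = U c v - c v := by
      simp_rw [ha, mul_sub, Finset.sum_sub_distrib, Fin.val_inj]
      simp [U]
    have h4 : ∑ j : Fin M, c j * ∑ i ∈ Finset.range (M - v + 1),
        a i * ∫ w, genCoef G j (w + i) ∂κ M =
        ∑ i ∈ Finset.range (M - v + 1), a i * ∫ w, U c (w + i) ∂κ M := by
      simp_rw [Finset.mul_sum]
      rw [Finset.sum_comm]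
      refine Finset.sum_congr rfl fun i _ => ?_
      rw [integral_finsetSum _ fun (j : Fin M) _ =>
        (integrable_of_norm_le (κ M) fun w => hD j (w + i)).const_mul (c j), Finset.mul_sum]
      refine Finset.sum_congr rfl fun j _ => ?_
      rw [integral_const_mul]
      ring
    rw [h4] at h3
    simp_rw [hUz] at h3
    simpa using h3.symm
  obtain ⟨c, hc⟩ := LinearMap.injective_iff_surjective.1 hinj
    (fun v : Fin M => if (v : ℕ) = 0 then 1 else 0)
  have hc' : ∀ v : Fin M, (if (v : ℕ) = 0 then U c v else U c v - ∫ w, U c w ∂κ v) =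
      if (v : ℕ) = 0 then 1 else 0 := fun v => by rw [← hA]; exact congrFun hc v
  have hone : U c 0 = 1 := by simpa using hc' ⟨0, hM⟩
  have hharm : ∀ v, 1 ≤ v → ∫ w, U c w ∂κ v = U c v := fun v hv => by
    rcases lt_or_ge v M with h | h
    · have := hc' ⟨v, h⟩
      rw [if_neg (by simp; omega), if_neg (by simp; omega)] at this
      simp only at this
      linarith
    · exact hUup c v h
  -- positivity
  have hnonneg : ∀ v, 0 ≤ U c v := fun v => by
    have := le_zero_of_harmonic hκ (f := fun v => -U c v) (by simpa using (hU0 c).neg)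
      one_pos (fun v hv => by rw [Nat.lt_one_iff.1 hv, hone]; norm_num)
      (fun v hv => by rw [integral_neg, hharm v hv]) v
    linarith
  have hUi : ∀ (ν : Measure ℕ) [IsProbabilityMeasure ν], Integrable (U c) ν := fun ν _ =>
    integrable_finsetSum _ fun (j : Fin M) _ => (hint ν j).const_mul (c j)
  have hUpos : ∀ v, 0 < U c v := fun v => by
    rcases Nat.eq_zero_or_pos v with rfl | hv
    · rw [hone]; exact one_pos
    · rw [← hharm v hv]
      exact pos_of_harmonic_of_nonneg (hκ v) hnonneg (hUi _) (by rw [hone]; exact one_pos)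
  obtain ⟨H, cH, hcH, hHeq, hHlim⟩ := exists_genSum_zero_eq hδ hG hGpos
  obtain ⟨D₀, hD₀⟩ := exists_norm_genSum_le hδ hG
  have hHb : ∀ n, ‖H n‖ ≤ D₀ := fun n => by
    have := hD₀ 0 (by simp) n
    rwa [hHeq, Complex.norm_real] at this
  have hHharm : ∀ v, M ≤ v → ∫ w, H w ∂κ v = H v := fun v hv => by
    have := sum_mul_integral_genSum _ _ (fun _ : Unit => κ v) hδ hG (hgfv v hv)
      (s := 0) (by simp)
    simp only [hHeq, Finset.sum_singleton, Complex.ofReal_one, one_mul] at this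
    -- At s = 0 the source 0^v vanishes because v ≥ M > 0.
    rw [zero_pow (by omega), sub_zero, integral_complex_ofReal] at this
    exact_mod_cast this
  obtain ⟨v₁, -, hv₁⟩ := Finset.exists_min_image (Finset.range M) (U c) ⟨0, by simpa using hM⟩
  have hD₀0 : 0 ≤ D₀ := (norm_nonneg _).trans (hHb 0)
  -- Chosen so that εH ≤ U on the levels below M, where H need not be harmonic; the maximum
  -- principle from level M extends the inequality. The 1 keeps the denominator positive.
  set ε := U c v₁ / (D₀ + 1) with hε
  have hε0 : 0 < ε := div_pos (hUpos v₁) (by linarith)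
  have hcomp : ∀ v, ε * H v - U c v ≤ 0 := by
    refine le_zero_of_harmonic hκ ?_ hM (fun v hv => ?_) (fun v hv => ?_)
    · have := ((tendsto_zero_of_rpow_mul hδ hHlim).const_mul ε).sub (hU0 c)
      simpa using this
    · have h3 := hv₁ v (by simpa using hv)
      have h4 : ε * H v ≤ ε * (D₀ + 1) := by
        gcongr
        linarith [(le_abs_self (H v)).trans (hHb v)]
      have h5 : ε * (D₀ + 1) = U c v₁ := by
        rw [hε]
        field_simp
      linarith
    · rw [integral_sub ((integrable_of_norm_le _ hHb).const_mul ε) (hUi _), integral_const_mul,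
        hHharm v hv, hUup c v hv]
  refine ⟨U c, hone, hU0 c, hharm, _, ?_, hUL c⟩
  refine lt_of_lt_of_le (mul_pos hε0 hcH)
    (le_of_tendsto_of_tendsto' (hHlim.const_mul ε) (hUL c) fun n => ?_)
  have h3 : 0 ≤ (n : ℝ) ^ (δ - 1) := by positivity
  have := mul_nonneg h3 (sub_nonneg.2 (sub_nonpos.1 (hcomp n)))
  linarith

/-! ### Offspring laws, independence and the one-step kernel -/

theorem pgf_zero (ν : Measure ℕ) : pgf ν 0 = (ν.real {0} : ℝ) := by
  have : (fun w : ℕ => (0 : ℂ) ^ w) = Set.indicator {0} fun _ => 1 := by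
    ext w
    rcases Nat.eq_zero_or_pos w with rfl | hw
    · simp
    · rw [zero_pow hw.ne', Set.indicator_of_notMem (by simpa using hw.ne')]
  rw [pgf, this, integral_indicator_const _ (measurableSet_singleton 0)]
  simp

theorem pgf_geometricMeasure {z : ℂ} (hz : ‖z‖ ≤ 1) :
    pgf (geometricMeasure halfParam) z = 1 / (2 - z) := by
  have hp : halfParam ≠ 0 := by
    intro h
    have := congrArg Subtype.val h
    simp [halfParam] at this
  have h := hasSum_integral_geometricMeasure hp
    (integrable_of_norm_le _ (norm_pow_le_one_of_norm_le_one hz))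
  have hz2 : ‖z / 2‖ < 1 := by
    rw [norm_div]
    norm_num
    linarith
  have h2 := (hasSum_geometric_of_norm_lt_one hz2).mul_right (1 / 2)
  have h3 : (fun n : ℕ => (((1 - (halfParam : ℝ)) ^ n * (halfParam : ℝ) : ℝ)) • z ^ n) =
      fun n => (z / 2) ^ n * (1 / 2) := by
    ext n
    rw [Complex.real_smul, div_pow]
    simp only [halfParam]
    push_cast
    rw [show (1 - 1 / 2 : ℂ) = 1 / 2 by norm_num, div_pow, one_pow]
    ring
  rw [h3] at h
  have h0 := two_sub_ne_zero_of_norm_le_one hz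
  rw [pgf, h.unique h2, show (1 - z / 2 : ℂ) = (2 - z) / 2 by ring, inv_div]
  field_simp

/-- The sum of the first `v` terms of a sequence, jointly in `v` and the sequence. -/
def partialSum (p : ℕ × (ℕ → ℕ)) : ℕ := ∑ m ∈ Finset.range p.1, p.2 m

theorem measurable_partialSum : Measurable partialSum :=
  measurable_from_prod_countable_right fun v => by
    change Measurable fun x : ℕ → ℕ => ∑ m ∈ Finset.range v, x m
    exact Finset.measurable_fun_sum _ fun m _ => measurable_pi_apply m

section Offspring

variable {Ω : Type*} {M : ℕ} {ξ : ℕ → ℕ → Ω → ℕ}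

theorem measurable_offspring_iSup {S : Set (ℕ ⊕ (ℕ × ℕ))} {k m : ℕ}
    (h₁ : m < M → Sum.inl k ∈ S) (h₂ : ∀ j, m = M + j → Sum.inr (k, j) ∈ S) :
    Measurable[⨆ i ∈ S, offspringSigma M ξ i] (ξ k m) := by
  rcases lt_or_ge m M with hm | hm
  · have h : Measurable[offspringSigma M ξ (Sum.inl k)] (ξ k m) :=
      (measurable_pi_apply (⟨m, hm⟩ : Fin M)).comp (comap_measurable (firstOffspring M ξ k))
    exact h.mono (le_iSup₂_of_le _ (h₁ hm) le_rfl) le_rfl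
  · obtain ⟨j, rfl⟩ := Nat.exists_eq_add_of_le hm
    have h : Measurable[offspringSigma M ξ (Sum.inr (k, j))] (ξ k (M + j)) :=
      comap_measurable _
    exact h.mono (le_iSup₂_of_le _ (h₂ j rfl) le_rfl) le_rfl

theorem measurable_offspring_iSup_seq {S : Set (ℕ ⊕ (ℕ × ℕ))} {k : ℕ}
    (h₁ : Sum.inl k ∈ S) (h₂ : ∀ j, Sum.inr (k, j) ∈ S) :
    Measurable[⨆ i ∈ S, offspringSigma M ξ i] fun ω m => ξ k m ω := by
  have hpi : ∀ {mΩ : MeasurableSpace Ω}, (∀ m, Measurable (ξ k m)) →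
      Measurable fun ω m => ξ k m ω := fun h => measurable_pi_lambda _ h
  exact hpi fun m => measurable_offspring_iSup (fun _ => h₁) (fun j _ => h₂ j)

/-- The population at time k uses only generations before k; this gives its independence from
generation k. -/
theorem measurable_forwardBP_iSup (n k : ℕ) :
    Measurable[⨆ i ∈ {i : ℕ ⊕ (ℕ × ℕ) | Sum.elim id Prod.fst i < k}, offspringSigma M ξ i]
      (forwardBP ξ n k) := by
  induction k with
  | zero =>
    have : forwardBP ξ n 0 = fun _ => n := rfl
    rw [this]
    exact measurable_const
  | succ k ih =>
    have h1 := ih.mono (ma' := ⨆ i ∈ {i : ℕ ⊕ (ℕ × ℕ) | Sum.elim id Prod.fst i < k + 1},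
      offspringSigma M ξ i)
      (biSup_mono fun i hi => lt_trans hi (Nat.lt_succ_self k)) le_rfl
    have h2 : Measurable[⨆ i ∈ {i : ℕ ⊕ (ℕ × ℕ) | Sum.elim id Prod.fst i < k + 1},
        offspringSigma M ξ i] fun ω m => ξ k m ω :=
      measurable_offspring_iSup_seq (by simp) (fun j => by simp)
    exact measurable_partialSum.comp (h1.prodMk h2)

/-- The number of children of the first `v` individuals of generation `k`. -/
def offspringSum (ξ : ℕ → ℕ → Ω → ℕ) (k v : ℕ) (ω : Ω) : ℕ := ∑ m ∈ Finset.range v, ξ k m ω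

theorem offspringSum_succ (k v : ℕ) :
    offspringSum ξ k (v + 1) = offspringSum ξ k v + ξ k v := by
  ext ω
  simp [offspringSum, Finset.sum_range_succ]

variable [mΩ : MeasurableSpace Ω] {μ : Measure Ω}

theorem measurable_firstOffspring (hξ : IsForwardOffspring μ M ξ) (k : ℕ) :
    Measurable (firstOffspring M ξ k) :=
  measurable_pi_lambda _ fun m => hξ.measurable k m

theorem offspringSigma_le (hξ : IsForwardOffspring μ M ξ) (i : ℕ ⊕ (ℕ × ℕ)) :
    offspringSigma M ξ i ≤ mΩ := by
  rcases i with k | ⟨k, j⟩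
  · exact (measurable_firstOffspring hξ k).comap_le
  · exact (hξ.measurable k (M + j)).comap_le

theorem measurable_forwardBP (hξ : IsForwardOffspring μ M ξ) (n k : ℕ) :
    Measurable (forwardBP ξ n k) :=
  (measurable_forwardBP_iSup (M := M) n k).mono
    (iSup₂_le fun i _ => offspringSigma_le hξ i) le_rfl

theorem indepFun_forwardBP_offspring (hξ : IsForwardOffspring μ M ξ) (n k : ℕ) :
    IndepFun (forwardBP ξ n k) (fun ω m => ξ k m ω) μ := by
  have h := indep_iSup_of_disjoint (offspringSigma_le hξ) hξ.indep
    (S := {i | Sum.elim id Prod.fst i < k}) (T := {i | Sum.elim id Prod.fst i = k})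
    (Set.disjoint_left.2 fun i (h1 : _ < k) (h2 : _ = k) => h1.ne h2)
  have h2 : Measurable[⨆ i ∈ {i : ℕ ⊕ (ℕ × ℕ) | Sum.elim id Prod.fst i = k},
      offspringSigma M ξ i] fun ω m => ξ k m ω :=
    measurable_offspring_iSup_seq (by simp) (fun j => by simp)
  exact indep_of_indep_of_le_left (indep_of_indep_of_le_right h h2.comap_le)
    (measurable_forwardBP_iSup n k).comap_le

theorem measurable_offspringSum (hξ : IsForwardOffspring μ M ξ) (k v : ℕ) :
    Measurable (offspringSum ξ k v) :=
  Finset.measurable_fun_sum _ fun m _ => hξ.measurable k m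

theorem indepFun_offspringSum (hξ : IsForwardOffspring μ M ξ) (k : ℕ) {v : ℕ} (hv : M ≤ v) :
    IndepFun (offspringSum ξ k v) (ξ k v) μ := by
  obtain ⟨l, rfl⟩ := Nat.exists_eq_add_of_le hv
  have h := indep_iSup_of_disjoint (offspringSigma_le hξ) hξ.indep
    (S := {Sum.inr (k, l)}ᶜ) (T := {Sum.inr (k, l)}) disjoint_compl_left
  have h1 : Measurable[⨆ i ∈ ({Sum.inr (k, l)}ᶜ : Set (ℕ ⊕ (ℕ × ℕ))), offspringSigma M ξ i]
      (offspringSum ξ k (M + l)) :=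
    Finset.measurable_fun_sum _ fun m hm => measurable_offspring_iSup (fun _ => by simp)
      (fun j hj => by
        rw [Finset.mem_range] at hm
        simp only [Set.mem_compl_iff, Set.mem_singleton_iff, Sum.inr.injEq, Prod.mk.injEq,
          true_and]
        omega)
  have h2 : Measurable[⨆ i ∈ ({Sum.inr (k, l)} : Set (ℕ ⊕ (ℕ × ℕ))), offspringSigma M ξ i]
      (ξ k (M + l)) :=
    measurable_offspring_iSup (fun h => by omega) (fun j hj => by
      have : l = j := by omega
      simp [this])
  exact indep_of_indep_of_le_left (indep_of_indep_of_le_right h h2.comap_le) h1.comap_le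

/-- The law of the number of children of the first `v` individuals. -/
def offspringLaw (μ : Measure Ω) (ξ : ℕ → ℕ → Ω → ℕ) (v : ℕ) : Measure ℕ :=
  μ.map (offspringSum ξ 0 v)

/-- Each individual beyond the first M adds an independent geometric variable, hence one factor 1/(2
- z). -/
theorem pgf_offspringLaw (hξ : IsForwardOffspring μ M ξ) {v : ℕ} (hv : M ≤ v) {z : ℂ}
    (hz : ‖z‖ ≤ 1) :
    pgf (offspringLaw μ ξ v) z = pgf (offspringLaw μ ξ M) z * (1 / (2 - z)) ^ (v - M) := by
  have hpgf : ∀ X : Ω → ℕ, Measurable X → pgf (μ.map X) z = ∫ ω, z ^ X ω ∂μ := fun X hX =>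
    integral_map hX.aemeasurable (StronglyMeasurable.of_discrete).aestronglyMeasurable
  induction v, hv using Nat.le_induction with
  | base => simp
  | succ v hv ih =>
    have hm := measurable_offspringSum hξ 0 v
    have hi := (indepFun_offspringSum hξ 0 hv).comp (φ := fun w : ℕ => z ^ w)
      (ψ := fun w : ℕ => z ^ w) Measurable.of_discrete Measurable.of_discrete
    have hpow : Measurable fun w : ℕ => z ^ w := Measurable.of_discrete
    have hprod := hi.integral_fun_mul_eq_mul_integral
      (hpow.comp hm).aestronglyMeasurable (hpow.comp (hξ.measurable 0 v)).aestronglyMeasurable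
    rw [offspringLaw, hpgf _ (measurable_offspringSum hξ 0 (v + 1)), offspringSum_succ]
    simp only [Pi.add_apply, pow_add]
    simp only [Function.comp] at hprod
    rw [hprod, ← hpgf _ hm, ← hpgf _ (hξ.measurable 0 v), (hξ.geometric 0 v hv).map_eq,
      pgf_geometricMeasure hz, Nat.succ_sub hv, pow_succ, ← mul_assoc, ← ih, offspringLaw]

theorem memLp_two_offspring (hξ : IsForwardOffspring μ M ξ) {m : ℕ} (hm : m < M) :
    MemLp (fun ω => (ξ 0 m ω : ℝ)) 2 μ := by
  have hmeas : Measurable fun ω => (ξ 0 m ω : ℝ) :=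
    Measurable.comp (Measurable.of_discrete (f := fun n : ℕ => (n : ℝ))) (hξ.measurable 0 m)
  rw [memLp_two_iff_integrable_sq hmeas.aestronglyMeasurable]
  refine (hξ.fourth_moment m hm).mono' (hmeas.pow_const 2).aestronglyMeasurable
    (Eventually.of_forall fun ω => ?_)
  rw [Real.norm_of_nonneg (by positivity)]
  have : ξ 0 m ω ^ 2 ≤ ξ 0 m ω ^ 4 := by
    rcases Nat.eq_zero_or_pos (ξ 0 m ω) with h | h
    · simp [h]
    · exact Nat.pow_le_pow_right h (by norm_num)
  exact_mod_cast this

theorem integrable_sq_offspringLaw (hξ : IsForwardOffspring μ M ξ) :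
    Integrable (fun w : ℕ => (w : ℝ) ^ 2) (offspringLaw μ ξ M) := by
  rw [offspringLaw, integrable_map_measure (StronglyMeasurable.of_discrete).aestronglyMeasurable
    (measurable_offspringSum hξ 0 M).aemeasurable]
  have h : MemLp (fun ω => ∑ m ∈ Finset.range M, (ξ 0 m ω : ℝ)) 2 μ :=
    memLp_finsetSum _ fun m hm => memLp_two_offspring hξ (by simpa using hm)
  refine h.integrable_sq.congr (Eventually.of_forall fun ω => ?_)
  simp [offspringSum]

variable [IsProbabilityMeasure μ]

theorem isProbabilityMeasure_offspringLaw (hξ : IsForwardOffspring μ M ξ) (v : ℕ) :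
    IsProbabilityMeasure (offspringLaw μ ξ v) :=
  Measure.isProbabilityMeasure_map (measurable_offspringSum hξ 0 v).aemeasurable

/-- Time homogeneity: up to M it comes from the identically distributed vectors, beyond M from
convolution with the geometric law. -/
theorem map_offspringSum (hξ : IsForwardOffspring μ M ξ) (k v : ℕ) :
    μ.map (offspringSum ξ k v) = offspringLaw μ ξ v := by
  have hle : ∀ v ≤ M, μ.map (offspringSum ξ k v) = offspringLaw μ ξ v := fun v hv => by
    have hS : ∀ k, offspringSum ξ k v =
        (fun x : Fin M → ℕ => ∑ m : Fin v, x (Fin.castLE hv m)) ∘ firstOffspring M ξ k := by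
      intro k
      ext ω
      simp [offspringSum, firstOffspring, Finset.sum_range]
    rw [offspringLaw, hS k, hS 0]
    exact ((hξ.identDistrib k).comp (Measurable.of_discrete)).map_eq
  rcases le_total v M with h | h
  · exact hle v h
  · induction v, h using Nat.le_induction with
    | base => exact hle M le_rfl
    | succ v hv ih =>
      have hc : ∀ k, μ.map (offspringSum ξ k (v + 1)) =
          (μ.map (offspringSum ξ k v)).conv (geometricMeasure halfParam) := fun k => by
        rw [offspringSum_succ, (indepFun_offspringSum hξ k hv).map_add_eq_map_conv_map
          (measurable_offspringSum hξ k v) (hξ.measurable k v), (hξ.geometric k v hv).map_eq]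
      rw [offspringLaw, hc k, hc 0, ih, offspringLaw]

theorem offspringLaw_singleton_zero_ne_zero (hξ : IsForwardOffspring μ M ξ) (v : ℕ) :
    offspringLaw μ ξ v {0} ≠ 0 := by
  have hle : ∀ v ≤ M, offspringLaw μ ξ v {0} ≠ 0 := fun v hv => by
    rw [offspringLaw, Measure.map_apply (measurable_offspringSum hξ 0 v)
      (measurableSet_singleton 0)]
    refine (lt_of_lt_of_le hξ.vanish_pos (measure_mono fun ω hω => ?_)).ne'
    have hω : firstOffspring M ξ 0 ω = 0 := hω
    simp only [Set.mem_preimage, Set.mem_singleton_iff, offspringSum, Finset.sum_eq_zero_iff,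
      Finset.mem_range]
    exact fun m hm => congrFun hω ⟨m, by omega⟩
  rcases le_total v M with h | h
  · exact hle v h
  · have := isProbabilityMeasure_offspringLaw hξ
    have h1 := pgf_offspringLaw hξ h (z := 0) (by simp)
    rw [pgf_zero, pgf_zero] at h1
    intro h0
    rw [measureReal_def, h0] at h1
    have h2 : (offspringLaw μ ξ M).real {0} ≠ 0 := by
      rw [measureReal_def]
      exact ENNReal.toReal_ne_zero.2 ⟨hle M le_rfl, measure_ne_top _ _⟩
    have h3 : (((offspringLaw μ ξ M).real {0} : ℝ) : ℂ) * (1 / (2 - 0)) ^ (v - M) ≠ 0 :=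
      mul_ne_zero (by exact_mod_cast h2) (pow_ne_zero _ (by norm_num))
    exact h3 (by simpa using h1.symm)

theorem integral_offspringLaw (hξ : IsForwardOffspring μ M ξ) :
    ∫ w, (w : ℝ) ∂offspringLaw μ ξ M = M + driftParam μ M ξ := by
  have hi : ∀ m ∈ Finset.range M, Integrable (fun ω => (ξ 0 m ω : ℝ)) μ := fun m hm =>
    (memLp_two_offspring hξ (by simpa using hm)).integrable (by norm_num)
  rw [offspringLaw, integral_map (measurable_offspringSum hξ 0 M).aemeasurable
    (StronglyMeasurable.of_discrete).aestronglyMeasurable, driftParam]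
  simp only [offspringSum, Nat.cast_sum]
  have h : ∫ ω, ∑ m ∈ Finset.range M, ((ξ 0 m ω : ℝ) - 1) ∂μ =
      ∑ m ∈ Finset.range M, (∫ ω, (ξ 0 m ω : ℝ) ∂μ - 1) := by
    rw [integral_finsetSum _ fun m hm => by exact (hi m hm).sub (integrable_const _)]
    refine Finset.sum_congr rfl fun m hm => ?_
    rw [integral_sub (hi m hm) (integrable_const _)]
    simp
  rw [integral_finsetSum _ hi, h, Finset.sum_sub_distrib]
  simp

/-- The Markov property, from the product form of the joint law of the current size and the next
offspring sequence. -/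
theorem integral_map_forwardBP_succ (hξ : IsForwardOffspring μ M ξ) (n k : ℕ) {φ : ℕ → ℝ} {D : ℝ}
    (hφ : ∀ w, ‖φ w‖ ≤ D) :
    ∫ w, φ w ∂μ.map (forwardBP ξ n (k + 1)) =
      ∫ v, ∫ w, φ w ∂offspringLaw μ ξ v ∂μ.map (forwardBP ξ n k) := by
  have hV := measurable_forwardBP hξ n k
  have hX : Measurable fun ω m => ξ k m ω := measurable_pi_lambda _ fun m => hξ.measurable k m
  have hφm : Measurable φ := Measurable.of_discrete
  have := Measure.isProbabilityMeasure_map (μ := μ) hV.aemeasurable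
  have := Measure.isProbabilityMeasure_map (μ := μ) hX.aemeasurable
  have h1 : forwardBP ξ n (k + 1) =
      partialSum ∘ fun ω => (forwardBP ξ n k ω, fun m => ξ k m ω) := rfl
  rw [h1, ← Measure.map_map measurable_partialSum (hV.prodMk hX),
    (indepFun_iff_map_prod_eq_prod_map_map hV.aemeasurable hX.aemeasurable).1
      (indepFun_forwardBP_offspring hξ n k),
    integral_map measurable_partialSum.aemeasurable hφm.aestronglyMeasurable,
    integral_prod (fun p => φ (partialSum p)) (Integrable.of_bound (hφm.comp measurable_partialSum).aestronglyMeasurable D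
      (Eventually.of_forall fun p => hφ _))]
  congr 1
  ext v
  rw [← map_offspringSum hξ k v,
    integral_map (measurable_offspringSum hξ k v).aemeasurable hφm.aestronglyMeasurable,
    integral_map hX.aemeasurable]
  · rfl
  · exact (hφm.comp (measurable_partialSum.comp measurable_prodMk_left)).aestronglyMeasurable

/-! ### Absorption, transience and identification of the extinction probability -/

theorem offspringLaw_zero : offspringLaw μ ξ 0 = Measure.dirac 0 := by
  have : offspringSum ξ 0 0 = fun _ : Ω => 0 := by
    ext ω
    simp [offspringSum]
  rw [offspringLaw, this, Measure.map_const]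
  simp

theorem integral_map_forwardBP_of_harmonic (hξ : IsForwardOffspring μ M ξ) (n k : ℕ) {u : ℕ → ℝ}
    {D : ℝ} (hD : ∀ w, ‖u w‖ ≤ D)
    (hu : ∀ v, 0 < v → ∫ w, u w ∂offspringLaw μ ξ v = u v) :
    ∫ w, u w ∂μ.map (forwardBP ξ n k) = u n := by
  have hu' : ∀ v, ∫ w, u w ∂offspringLaw μ ξ v = u v := fun v => by
    rcases Nat.eq_zero_or_pos v with rfl | hv
    · rw [offspringLaw_zero, integral_dirac]
    · exact hu v hv
  induction k with
  | zero =>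
    have : forwardBP ξ n 0 = fun _ : Ω => n := rfl
    rw [this, Measure.map_const]
    simp
  | succ k ih =>
    rw [integral_map_forwardBP_succ hξ n k hD]
    simp_rw [hu']
    exact ih

theorem tendsto_map_forwardBP_zero (hξ : IsForwardOffspring μ M ξ) (n : ℕ) :
    Tendsto (fun k => (μ.map (forwardBP ξ n k)).real {0}) atTop (𝓝 (extinctionProb μ ξ n)) := by
  have hset : {ω | entranceTime (fun k => forwardBP ξ n k ω) 0 < ⊤} =
      ⋃ k, {ω | forwardBP ξ n k ω = 0} := by
    ext ω
    simp only [entranceTime, Set.mem_ofPred_eq, Set.mem_iUnion, iInf_lt_iff, Nat.le_zero]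
    constructor
    · rintro ⟨k, hk, -⟩
      exact ⟨k, hk⟩
    · rintro ⟨k, hk⟩
      exact ⟨k, hk, ENat.natCast_lt_top k⟩
  have hmono : Monotone fun k => {ω | forwardBP ξ n k ω = 0} :=
    monotone_nat_of_le_succ fun k ω (hω : forwardBP ξ n k ω = 0) => by
      change forwardBP ξ n (k + 1) ω = 0
      rw [forwardBP, hω, Finset.range_zero, Finset.sum_empty]
  have h := tendsto_measure_iUnion_atTop (μ := μ) hmono
  rw [← hset] at h
  refine ((ENNReal.tendsto_toReal (measure_ne_top _ _)).comp h).congr fun k => ?_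
  rw [measureReal_def, Measure.map_apply (measurable_forwardBP hξ n k)
    (measurableSet_singleton 0)]
  rfl

/-- From v the process is absorbed at once with probability q > 0, so q P(V_k = v) is at most the
increase of P(V_k = 0), which tends to 0 because that sequence converges. -/
theorem tendsto_map_forwardBP_singleton (hξ : IsForwardOffspring μ M ξ) (n : ℕ) {v : ℕ}
    (hv : 0 < v) :
    Tendsto (fun k => (μ.map (forwardBP ξ n k)).real {v}) atTop (𝓝 0) := by
  have := isProbabilityMeasure_offspringLaw hξ
  have hlaw : ∀ k, IsProbabilityMeasure (μ.map (forwardBP ξ n k)) := fun k =>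
    Measure.isProbabilityMeasure_map (measurable_forwardBP hξ n k).aemeasurable
  set q := (offspringLaw μ ξ v).real {0} with hq
  have hq0 : 0 < q := by
    rw [hq, measureReal_def]
    exact ENNReal.toReal_pos (offspringLaw_singleton_zero_ne_zero hξ v) (measure_ne_top _ _)
  have hind : ∀ ν : Measure ℕ, ∀ w : ℕ, ∫ x, Set.indicator {w} (fun _ => (1 : ℝ)) x ∂ν =
      ν.real {w} := fun ν w => by
    rw [integral_indicator_const _ (measurableSet_singleton w), smul_eq_mul, mul_one]
  have hbd : ∀ w x : ℕ, ‖Set.indicator {w} (fun _ => (1 : ℝ)) x‖ ≤ 1 := fun w x => by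
    by_cases h : x ∈ ({w} : Set ℕ) <;> simp [h]
  have hstep : ∀ k, (μ.map (forwardBP ξ n k)).real {0} + q * (μ.map (forwardBP ξ n k)).real {v} ≤
      (μ.map (forwardBP ξ n (k + 1))).real {0} := fun k => by
    rw [← hind (μ.map (forwardBP ξ n (k + 1))) 0, integral_map_forwardBP_succ hξ n k (hbd 0),
      ← hind _ 0, ← hind _ v, ← integral_const_mul, ← integral_add
        (integrable_of_norm_le _ (hbd 0)) ((integrable_of_norm_le _ (hbd v)).const_mul q)]
    simp_rw [hind]
    refine integral_mono ((integrable_of_norm_le _ (hbd 0)).add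
      ((integrable_of_norm_le _ (hbd v)).const_mul q))
      (integrable_of_norm_le _ (D := 1) fun w => ?_) fun w => ?_
    · rw [Real.norm_of_nonneg measureReal_nonneg]
      exact measureReal_le_one
    · simp only
      by_cases h0 : w = 0
      · subst h0
        simp [offspringLaw_zero, hv.ne, measureReal_def]
      · by_cases h1 : w = v
        · subst h1
          simp [h0, hq]
        · simp [h0, h1]
  have hlim := tendsto_map_forwardBP_zero hξ n
  have hdiff := (((tendsto_add_atTop_iff_nat 1).2 hlim).sub hlim).const_mul q⁻¹
  rw [sub_self, mul_zero] at hdiff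
  refine squeeze_zero (fun k => measureReal_nonneg) (fun k => ?_) hdiff
  rw [← div_eq_inv_mul, le_div_iff₀ hq0]
  linarith [hstep k]

/-- The weight |f v| in the hypothesis lets mass persist where f vanishes, as it may at the
absorbing state 0. -/
theorem tendsto_integral_zero_of_escape {ν : ℕ → Measure ℕ} [∀ k, IsProbabilityMeasure (ν k)]
    {f : ℕ → ℝ} (hf : Tendsto f atTop (𝓝 0))
    (h : ∀ v, Tendsto (fun k => |f v| * (ν k).real {v}) atTop (𝓝 0)) :
    Tendsto (fun k => ∫ w, f w ∂ν k) atTop (𝓝 0) := by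
  obtain ⟨D, hD⟩ : ∃ D, ∀ w, ‖f w‖ ≤ D := by
    obtain ⟨D, hD⟩ := (hf.norm.bddAbove_range)
    exact ⟨D, fun w => hD ⟨w, rfl⟩⟩
  rw [Metric.tendsto_nhds]
  intro ε hε
  obtain ⟨K, hK⟩ := eventually_atTop.1 (Metric.tendsto_nhds.1 hf (ε / 2) (by linarith))
  have hsum : Tendsto (fun k => ∑ v ∈ Finset.range K, |f v| * (ν k).real {v}) atTop (𝓝 0) := by
    simpa using tendsto_finsetSum (Finset.range K) fun v _ => h v
  filter_upwards [hsum.eventually (gt_mem_nhds (by linarith : 0 < ε / 2))] with k hk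
  rw [dist_zero_right]
  have hi : ∀ v ∈ Finset.range K,
      Integrable (fun w => |f v| * Set.indicator {v} (fun _ => (1 : ℝ)) w) (ν k) := fun v _ =>
    Integrable.const_mul (integrable_of_norm_le _ (D := 1) fun x => by
      by_cases h : x ∈ ({v} : Set ℕ) <;> simp [h]) _
  calc ‖∫ w, f w ∂ν k‖
      ≤ ∫ w, (∑ v ∈ Finset.range K, |f v| * Set.indicator {v} (fun _ => (1 : ℝ)) w + ε / 2)
          ∂ν k := by
        refine norm_integral_le_of_norm_le ((integrable_finsetSum _ hi).add (integrable_const _))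
          (Eventually.of_forall fun w => ?_)
        have hnn : ∀ v ∈ Finset.range K,
            0 ≤ |f v| * Set.indicator {v} (fun _ => (1 : ℝ)) w := fun v _ =>
          mul_nonneg (abs_nonneg _) (Set.indicator_nonneg (fun _ _ => zero_le_one) _)
        rcases lt_or_ge w K with hw | hw
        · have := Finset.single_le_sum hnn (Finset.mem_range.2 hw)
          simp only [Set.mem_singleton_iff, Set.indicator_of_mem, mul_one] at this
          rw [Real.norm_eq_abs]
          linarith
        · have h1 := hK w hw
          rw [dist_zero_right] at h1
          linarith [Finset.sum_nonneg hnn]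
    _ = ∑ v ∈ Finset.range K, |f v| * (ν k).real {v} + ε / 2 := by
        rw [integral_add (integrable_finsetSum _ hi) (integrable_const _),
          integral_finsetSum _ hi]
        congr 1
        · refine Finset.sum_congr rfl fun v _ => ?_
          rw [integral_const_mul, integral_indicator_const _ (measurableSet_singleton v),
            smul_eq_mul, mul_one]
        · simp
    _ < ε := by linarith

theorem extinctionProb_eq_of_harmonic (hξ : IsForwardOffspring μ M ξ) {u : ℕ → ℝ} (h0 : u 0 = 1)
    (hlim : Tendsto u atTop (𝓝 0)) (hu : ∀ v, 0 < v → ∫ w, u w ∂offspringLaw μ ξ v = u v)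
    (n : ℕ) : extinctionProb μ ξ n = u n := by
  have hlaw : ∀ k, IsProbabilityMeasure (μ.map (forwardBP ξ n k)) := fun k =>
    Measure.isProbabilityMeasure_map (measurable_forwardBP hξ n k).aemeasurable
  obtain ⟨D, hD⟩ : ∃ D, ∀ w, ‖u w‖ ≤ D := by
    obtain ⟨D, hD⟩ := (hlim.norm.bddAbove_range)
    exact ⟨D, fun w => hD ⟨w, rfl⟩⟩
  have hbd : ∀ x : ℕ, ‖Set.indicator {0} (fun _ => (1 : ℝ)) x‖ ≤ 1 := fun x => by
    by_cases h : x ∈ ({0} : Set ℕ) <;> simp [h]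
  -- Subtracting the indicator makes the function vanish at 0, so only the transient states and
  -- infinity matter.
  have hf0 : Tendsto (fun w => u w - Set.indicator {0} (fun _ => (1 : ℝ)) w) atTop (𝓝 0) := by
    refine hlim.congr' ?_
    filter_upwards [eventually_gt_atTop 0] with w hw
    simp [hw.ne']
  have h := tendsto_integral_zero_of_escape (ν := fun k => μ.map (forwardBP ξ n k)) hf0
    fun v => by
      rcases Nat.eq_zero_or_pos v with rfl | hv
      · simp [h0]
      · simpa using (tendsto_map_forwardBP_singleton hξ n hv).const_mul _
  have h2 : ∀ k, ∫ w, (u w - Set.indicator {0} (fun _ => (1 : ℝ)) w) ∂μ.map (forwardBP ξ n k) =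
      u n - (μ.map (forwardBP ξ n k)).real {0} := fun k => by
    rw [integral_sub (integrable_of_norm_le _ hD) (integrable_of_norm_le _ hbd),
      integral_map_forwardBP_of_harmonic hξ n k hD hu,
      integral_indicator_const _ (measurableSet_singleton 0), smul_eq_mul, mul_one]
  simp_rw [h2] at h
  have h3 := tendsto_nhds_unique h ((tendsto_map_forwardBP_zero hξ n).const_sub (u n))
  linarith

end Offspring

end

theorem mainTheorem6 {Ω : Type*} [MeasurableSpace Ω] (μ : Measure Ω) [IsProbabilityMeasure μ]
    (M : ℕ) (ξ : ℕ → ℕ → Ω → ℕ) (hξ : IsForwardOffspring μ M ξ)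
    (hδ : 1 < driftParam μ M ξ) :
    ∃ c : ℝ, 0 < c ∧
      Tendsto (fun n : ℕ => (n : ℝ) ^ (driftParam μ M ξ - 1) * extinctionProb μ ξ n)
        atTop (𝓝 c) := by
  have hM : 0 < M := by
    by_contra h
    have hM : M = 0 := by omega
    subst hM
    simp [driftParam] at hδ
    linarith
  have := isProbabilityMeasure_offspringLaw hξ
  obtain ⟨u, hu0, hulim, hu, c, hc, hcl⟩ := exists_harmonic (κ := offspringLaw μ ξ)
    (offspringLaw_singleton_zero_ne_zero hξ) hM hδ (integrable_sq_offspringLaw hξ)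
    (integral_offspringLaw hξ) fun v hv z hz => pgf_offspringLaw hξ hv hz
  refine ⟨c, hc, ?_⟩
  simp_rw [extinctionProb_eq_of_harmonic hξ hu0 hulim hu]
  exact hcl
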